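/- Let $\Bbbk$ be a field of characteristic $0$, let $A$ be a commutative $\Bbbk$-algebra, and let $(A,\mathfrak h,\omega)$ be a Lie–Rinehart algebra: $\mathfrak h$ is a Lie algebra over $\Bbbk$ and an $A$-module, and the anchor $\omega\colon\mathfrak h\to\mathrm{Der}_{\Bbbk}(A)$ is an $A$-linear morphism of Lie algebras with $[X,aY]=a[X,Y]+\omega(X)(a)\,Y$. Assume that $\mathfrak h$ is projective as an $A$-module. Let $R$ be a commutative $\Bbbk$-algebra with a $\Bbbk$-algebra morphism $\eta\colon A\to R$ and a Lie algebra morphism $\rho\colon\mathfrak h\to\mathrm{Der}_{\Bbbk}(R)$ such that $\rho(X)(\eta(a))=\eta(\omega(X)(a))$ and $\rho(aX)=\eta(a)\rho(X)$ for all $a\in A$, $X\in\mathfrak h$. The universal enveloping algebra $\mathcal U_A(\mathfrak h)$ is the universal $\Bbbk$-algebra with a $\Bbbk$-algebra morphism $\iota_A\colon A\to\mathcal U_A(\mathfrak h)$ and a Lie algebra morphism $\iota_{\mathfrak h}\colon\mathfrak h\to\mathcal U_A(\mathfrak h)$ satisfying $\iota_{\mathfrak h}(aX)=\iota_A(a)\iota_{\mathfrak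 h}(X)$ and $\iota_{\mathfrak h}(X)\iota_A(a)-\iota_A(a)\iota_{\mathfrak h}(X)=\iota_A(\omega(X)(a))$. It is a cocommutative left Hopf algebroid over $A$ with source and target $\iota_A$ and with $\Delta(\iota_{\mathfrak h}(X))=\iota_{\mathfrak h}(X)\otimes_A1+1\otimes_A\iota_{\mathfrak h}(X)$, $\varepsilon(\iota_{\mathfrak h}(X))=0$. Here a cocommutative left Hopf algebroid over a commutative algebra $A$ is a left bialgebroid over $A$ with equal source and target $s$ and cocommutative coproduct for which the map $u\otimes v\mapsto u_{(1)}\otimes_A u_{(2)}v$ from $U\otimes U/\langle u\,s(a)\otimes v-u\otimes s(a)v\rangle$ to $U\otimes_AU$ (the tensor product of left $A$-modules) is bijective. Then: (a) $R$ is a left $\mathcal U_A(\mathfrak h)$-module algebra via $\iota_A(a)\cdot r=\eta(a)r$ and $\iota_{\mathfrak h}(X)\cdot r=\rho(X)(r)$. The smash product $R\,\#\,\mathcal U_A(\mathfrak h)$, that is, $R\otimes_A\mathcal U_A(\mathfrak h)$ with product $(r\otimes_A u)(r'\otimes_A u')=r(u_{(1)}\cdot r')\otimes_A u_{(2)}u'$,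 source and target $r\mapsto r\otimes_A1$, coproduct $r\otimes_A u\mapsto(r\otimes_A u_{(1)})\otimes_R(1\otimes_A u_{(2)})$ and counit $r\otimes_A u\mapsto r\,\eta(\varepsilon(u))$, is a cocommutative left Hopf algebroid over $R$. (b) The $R$-module $R\otimes_A\mathfrak h$ is a Lie–Rinehart algebra over $R$, denoted $R\rtimes_A\mathfrak h$, with bracket $$[r\otimes_A X,\,r'\otimes_A Y]=rr'\otimes_A[X,Y]-r'\rho(Y)(r)\otimes_A X+r\rho(X)(r')\otimes_A Y$$ and anchor $r\otimes_A X\mapsto r\rho(X)$. (c) There is an isomorphism $\mathcal U_R(R\rtimes_A\mathfrak h)\simeq R\,\#\,\mathcal U_A(\mathfrak h)$ of cocommutative left Hopf algebroids over $R$ with $$\iota_R(r)\mapsto r\otimes_A1,\qquad \iota_{R\otimes_A\mathfrak h}(r\otimes_A X)\mapsto r\otimes_A\iota_{\mathfrak h}(X),$$ and it is the only morphism of $\Bbbk$-algebras with these values. -/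

import Mathlib

open scoped TensorProduct

noncomputable section

/-! ### Cocommutative left bialgebroids and left Hopf algebroids

Throughout, `A` is a commutative `k`-algebra and `U` is an `A`-ring, that is, a `k`-algebra with a
(not necessarily central) `k`-algebra map `s : A → U`.  It is encoded by the left `A`-module
structure `a • u = s a * u`; the tower assumptions say precisely that `s a = a • 1` is a morphism
of `k`-algebras inducing this module structure.  A cocommutative left bialgebroid has source equal
to target, so `s` is both. -/

namespace LeftBialgebroid

section Basic

set_option linter.unusedSectionVars false

variable (k A U : Type*) [CommRing k] [CommRing A] [Algebra k A] [Ring U] [Algebra k U]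
  [Module A U] [IsScalarTower k A U] [IsScalarTower A U U]

/-- The source map `s : A → U` (equal to the target map). -/
def source : A →ₐ[k] U where
  toFun a := a • (1 : U)
  map_one' := one_smul A 1
  map_mul' a b := by rw [smul_mul_assoc, one_mul, mul_smul]
  map_zero' := zero_smul A 1
  map_add' a b := add_smul a b 1
  commutes' c := by rw [algebraMap_smul, Algebra.algebraMap_eq_smul_one]

/-- The canonical projection `U ⊗[k] U → U ⊗[A] U`, where `U ⊗[A] U` is the tensor product of the
left `A`-modules `U` and `U`, that is, `s a * u ⊗ v = u ⊗ s a * v`. -/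
def proj : U ⊗[k] U →ₗ[k] U ⊗[A] U := TensorProduct.mapOfCompatibleSMul A k k U U

/-- Factorwise multiplication from the right by an element of `U ⊗[k] U` on `U ⊗[A] U`:
`factorwiseMul (v ⊗ v') (u ⊗ u') = u * v ⊗ u' * v'`. -/
def factorwiseMul : U ⊗[k] U →ₗ[k] (U ⊗[A] U →ₗ[A] U ⊗[A] U) :=
  TensorProduct.lift <| LinearMap.mk₂ k
    (fun v v' => TensorProduct.map (LinearMap.mulRight A v) (LinearMap.mulRight A v'))
    (fun _ _ _ => by ext; simp [mul_add, TensorProduct.add_tmul])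
    (fun _ _ _ => by ext; simp [TensorProduct.smul_tmul'])
    (fun _ _ _ => by ext; simp [mul_add, TensorProduct.tmul_add])
    (fun _ _ _ => by ext; simp)

variable {k A U} in
@[simp] lemma proj_tmul (u v : U) : proj k A U (u ⊗ₜ[k] v) = u ⊗ₜ[A] v := rfl

variable {k A U} in
@[simp] lemma factorwiseMul_tmul (v v' u u' : U) :
    factorwiseMul k A U (v ⊗ₜ v') (u ⊗ₜ u') = (u * v) ⊗ₜ (u' * v') := rfl

variable {k A U} in
lemma factorwiseMul_tmul' (v v' : U) :
    factorwiseMul k A U (v ⊗ₜ v') =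
      TensorProduct.map (LinearMap.mulRight A v) (LinearMap.mulRight A v') := rfl

lemma proj_surjective : Function.Surjective (proj k A U) := fun x => by
  induction x with
  | zero => exact ⟨0, map_zero _⟩
  | tmul u v => exact ⟨u ⊗ₜ v, rfl⟩
  | add x y hx hy =>
    obtain ⟨x, rfl⟩ := hx
    obtain ⟨y, rfl⟩ := hy
    exact ⟨x + y, map_add _ _ _⟩

/-- `k`-linear relations `u * s a ⊗ v = u ⊗ s a * v` defining the domain of the Hopf-Galois map. -/
def balancedRel : Submodule k (U ⊗[k] U) :=
  Submodule.span k {x | ∃ (u v : U) (a : A),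
    x = (u * source k A U a) ⊗ₜ[k] v - u ⊗ₜ[k] (source k A U a * v)}

/-- The tensor product of the right `A`-module `U` (via `u * s a`) and the left `A`-module `U`
(via `s a * v`), the domain of the Hopf-Galois map. -/
abbrev BalancedTensor : Type _ := (U ⊗[k] U) ⧸ balancedRel k A U

variable [CoalgebraStruct A U]

open CoalgebraStruct

/-- The assignment `u ⊗ v ↦ u₍₁₎ ⊗ u₍₂₎ * v` on `U ⊗[k] U`. -/
def galoisAux : U ⊗[k] U →ₗ[k] U ⊗[A] U :=
  TensorProduct.lift <| LinearMap.mk₂ k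
    (fun u v => (LinearMap.mulRight A v).lTensor U (comul (R := A) u))
    (fun _ _ _ => by simp)
    (fun c u v => by
      rw [← algebraMap_smul A c u, map_smul, map_smul, algebraMap_smul])
    (fun u v w => by
      have : LinearMap.mulRight A (v + w) = LinearMap.mulRight A v + LinearMap.mulRight A w := by
        ext; simp [mul_add]
      rw [this, LinearMap.lTensor_add, LinearMap.add_apply])
    (fun c u v => by
      have : LinearMap.mulRight A (c • v) = algebraMap k A c • LinearMap.mulRight A v := by
        ext; simp
      rw [this, LinearMap.lTensor_smul, LinearMap.smul_apply, algebraMap_smul])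

/-- A cocommutative left bialgebroid over `A` (with `s = t`).  The coproduct and the counit are
left `A`-linear, as the coalgebra data `CoalgebraStruct A U` prescribe.  The coproduct takes values
in the Takeuchi product, and `comul_mul` says that it is multiplicative: the factorwise product
`Δ u * Δ v` is computed from an arbitrary lift `w` of `Δ v` to `U ⊗[k] U`. -/
class IsCocommLeftBialgebroid : Prop where
  coassoc : TensorProduct.assoc A U U U ∘ₗ (comul (R := A)).rTensor U ∘ₗ comul =
    (comul (R := A) (A := U)).lTensor U ∘ₗ comul
  rTensor_counit_comp_comul :
    (counit (R := A) (A := U)).rTensor U ∘ₗ comul = TensorProduct.mk A A U 1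
  lTensor_counit_comp_comul :
    (counit (R := A) (A := U)).lTensor U ∘ₗ comul = (TensorProduct.mk A U A).flip 1
  comul_comm : (TensorProduct.comm A U U).toLinearMap ∘ₗ comul = comul
  counit_one : counit (R := A) (1 : U) = 1
  counit_mul (u v : U) :
    counit (R := A) (u * v) = counit (R := A) (u * source k A U (counit (R := A) v))
  comul_takeuchi (u : U) (a : A) :
    (LinearMap.mulRight A (source k A U a)).rTensor U (comul (R := A) u) =
      (LinearMap.mulRight A (source k A U a)).lTensor U (comul (R := A) u)
  comul_one : comul (R := A) (1 : U) = 1 ⊗ₜ[A] 1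
  comul_mul (u v : U) (w : U ⊗[k] U) (hw : proj k A U w = comul (R := A) v) :
    comul (R := A) (u * v) = factorwiseMul k A U w (comul (R := A) u)

variable {k A U} in
@[simp] lemma galoisAux_tmul (u v : U) : galoisAux k A U (u ⊗ₜ v) =
    (LinearMap.mulRight A v).lTensor U (comul (R := A) u) := rfl

variable [IsCocommLeftBialgebroid k A U]

lemma comul_mul_source (u : U) (a : A) : comul (R := A) (u * source k A U a) =
    (LinearMap.mulRight A (source k A U a)).rTensor U (comul (R := A) u) := by
  have h : proj k A U (source k A U a ⊗ₜ 1) = comul (R := A) (source k A U a) := by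
    change (a • (1 : U)) ⊗ₜ[A] 1 = comul (R := A) (a • (1 : U))
    rw [map_smul, IsCocommLeftBialgebroid.comul_one k, TensorProduct.smul_tmul']
  rw [IsCocommLeftBialgebroid.comul_mul u _ _ h, factorwiseMul_tmul', LinearMap.mulRight_one]
  rfl

lemma balancedRel_le_ker : balancedRel k A U ≤ LinearMap.ker (galoisAux k A U) := by
  rw [balancedRel, Submodule.span_le]
  rintro _ ⟨u, v, a, rfl⟩
  rw [SetLike.mem_coe, LinearMap.mem_ker, map_sub, sub_eq_zero, galoisAux_tmul, galoisAux_tmul,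
    comul_mul_source, IsCocommLeftBialgebroid.comul_takeuchi]
  rw [← LinearMap.comp_apply, ← LinearMap.lTensor_comp]
  congr 2
  ext x
  simp [mul_assoc]

/-- The Hopf-Galois map `β : u ⊗ v ↦ u₍₁₎ ⊗ u₍₂₎ * v`. -/
def galoisMap : BalancedTensor k A U →ₗ[k] U ⊗[A] U :=
  (balancedRel k A U).liftQ (galoisAux k A U) (balancedRel_le_ker k A U)

end Basic

section Hopf

variable (k A U : Type*) [CommRing k] [CommRing A] [Algebra k A] [Ring U] [Algebra k U]
  [Module A U] [IsScalarTower k A U] [IsScalarTower A U U] [CoalgebraStruct A U]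

/-- A cocommutative left Hopf algebroid over `A`: a cocommutative left bialgebroid whose Hopf-Galois
map is invertible. -/
class IsCocommLeftHopfAlgebroid : Prop extends IsCocommLeftBialgebroid k A U where
  galoisMap_bijective : Function.Bijective (galoisMap k A U)

/-- The translation map `u ↦ u₊ ⊗ u₋ = β⁻¹ (u ⊗ 1)`. -/
def translation [IsCocommLeftHopfAlgebroid k A U] (u : U) : BalancedTensor k A U :=
  (LinearEquiv.ofBijective (galoisMap k A U)
    IsCocommLeftHopfAlgebroid.galoisMap_bijective).symm (u ⊗ₜ[A] 1)

variable (V : Type*) [Ring V] [Algebra k V] [Module A V] [IsScalarTower k A V]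
  [IsScalarTower A V V] [CoalgebraStruct A V]

/-- Isomorphisms of cocommutative left Hopf algebroids over `A`: bijective maps which are
multiplicative, left `A`-linear, counital and comultiplicative (being unital and `A`-linear, they
preserve source and target) and compatible with the translation maps, `f u₊ ⊗ f u₋ = (f u)₊ ⊗ (f u)₋`
(computed from arbitrary lifts to `U ⊗[k] U`). -/
structure HopfAlgebroidEquiv [IsCocommLeftHopfAlgebroid k A U] [IsCocommLeftHopfAlgebroid k A V]
    extends U ≃ₗc[A] V, U ≃* V where
  map_translation (u : U) (w : U ⊗[k] U) (hw : (balancedRel k A U).mkQ w = translation k A U u) :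
    (balancedRel k A V).mkQ
        (TensorProduct.map (toLinearMap.restrictScalars k) (toLinearMap.restrictScalars k) w) =
      translation k A V (toFun u)

instance [IsCocommLeftHopfAlgebroid k A U] [IsCocommLeftHopfAlgebroid k A V] :
    CoeFun (HopfAlgebroidEquiv k A U V) (fun _ => U → V) := ⟨fun e => e.toFun⟩

end Hopf

end LeftBialgebroid

/-! ### Module algebras and smash products -/

namespace LeftBialgebroid

section ModuleAlgebra

set_option linter.unusedSectionVars false

variable (k A U R : Type*) [CommRing k] [CommRing A] [Algebra k A] [Ring U] [Algebra k U]
  [Module A U] [IsScalarTower k A U] [IsScalarTower A U U] [CoalgebraStruct A U]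
  [CommRing R] [Algebra k R] [Algebra A R] [IsScalarTower k A R] [Module U R] [IsScalarTower A U R]

open CoalgebraStruct

/-- The `A`-linear map `U → R`, `u ↦ u • r`. -/
def orbitMap (r : R) : U →ₗ[A] R := (LinearMap.toSpanSingleton U R r).restrictScalars A

/-- A commutative algebra `R` which is a left `U`-module algebra over the cocommutative left
bialgebroid `U`.  The (symmetric) `A`-action on `R` induced by the `U`-action is the one given by
`Algebra A R`, because of `IsScalarTower A U R`. -/
class IsModuleAlgebra : Prop where
  source_smul_mul (a : A) (r r' : R) :
    (source k A U a • r) * r' = r * (source k A U a • r')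
  smul_mul (u : U) (r r' : R) : u • (r * r') =
    LinearMap.mul' A R (TensorProduct.map (orbitMap A U R r) (orbitMap A U R r') (comul u))
  smul_one (u : U) : u • (1 : R) = source k A U (counit u) • (1 : R)

/-- The smash product `R # U`: the `k`-vector space `R ⊗[A] U`. -/
@[nolint unusedArguments]
def Smash (_k A U R : Type*) [CommRing A] [Ring U] [Module A U] [CommRing R] [Algebra A R] :
    Type _ := R ⊗[A] U

namespace Smash

instance : AddCommGroup (Smash k A U R) := inferInstanceAs (AddCommGroup (R ⊗[A] U))

instance : Module R (Smash k A U R) := inferInstanceAs (Module R (R ⊗[A] U))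

instance : Module k (Smash k A U R) := inferInstanceAs (Module k (R ⊗[A] U))

instance : IsScalarTower k R (Smash k A U R) := inferInstanceAs (IsScalarTower k R (R ⊗[A] U))

variable {A U R} in
/-- The element `r # u`. -/
def tmul (r : R) (u : U) : Smash k A U R := r ⊗ₜ[A] u

variable {A U R} in
/-- For fixed `r'` and `u'`, the `A`-linear map `U ⊗[A] U → R ⊗[A] U`,
`x ⊗ y ↦ x • r' ⊗ y * u'`. -/
def mulAux (r' : R) (u' : U) : U ⊗[A] U →ₗ[A] R ⊗[A] U :=
  TensorProduct.map (orbitMap A U R r') (LinearMap.mulRight A u')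

variable {A U R} in
@[simp] lemma mulAux_tmul (r' : R) (u' x y : U) :
    mulAux r' u' (x ⊗ₜ[A] y) = (x • r') ⊗ₜ[A] (y * u') := rfl

variable {A U R} in
lemma mulAux_add_left (r r' : R) (u : U) :
    mulAux (A := A) (r + r') u = mulAux r u + mulAux r' u := by
  ext x y; simp [TensorProduct.add_tmul]

variable {A U R} in
lemma mulAux_zero_left (u : U) : mulAux (A := A) (0 : R) u = 0 := by
  ext x y; simp

variable {A U R} in
lemma mulAux_add_right (r : R) (u u' : U) :
    mulAux (A := A) r (u + u') = mulAux r u + mulAux r u' := by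
  ext x y; simp [mul_add, TensorProduct.tmul_add]

/-- For fixed `r'` and `u'`, the left `R`-linear map `r ⊗ u ↦ r * (u₍₁₎ • r') ⊗ u₍₂₎ * u'`. -/
def mulRightAux (r' : R) (u' : U) : R ⊗[A] U →ₗ[R] R ⊗[A] U :=
  LinearMap.liftBaseChange R (mulAux r' u' ∘ₗ comul)

variable {A U R} in
@[simp] lemma mulRightAux_tmul (r r' : R) (u u' : U) :
    mulRightAux A U R r' u' (r ⊗ₜ u) = r • mulAux r' u' (comul (R := A) u) := by
  simp [mulRightAux]

variable {k A U R} in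
lemma mulAux_smul (_ : IsCocommLeftBialgebroid k A U) (a : A) (r' : R) (u' u : U) :
    mulAux (a • r') u' (comul (R := A) u) = mulAux r' (a • u') (comul (R := A) u) := by
  have h := congrArg (mulAux r' u') (IsCocommLeftBialgebroid.comul_takeuchi (k := k) u a)
  have h1 : mulAux (A := A) (a • r') u' = mulAux r' u' ∘ₗ
      (LinearMap.mulRight A (source k A U a)).rTensor U := by
    ext x y; simp [source, mul_smul]
  have h2 : mulAux (A := A) r' (a • u') = mulAux r' u' ∘ₗ
      (LinearMap.mulRight A (source k A U a)).lTensor U := by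
    ext x y; simp [source, mul_assoc]
  rw [h1, h2]
  exact h

variable [IsCocommLeftBialgebroid k A U]

/-- Multiplication of the smash product, as an additive map in the second factor with values in
`R`-linear maps of the first factor. -/
def mulHom : R ⊗[A] U →+ (R ⊗[A] U →ₗ[R] R ⊗[A] U) :=
  TensorProduct.liftAddHom
    { toFun := fun r' =>
        { toFun := fun u' => mulRightAux A U R r' u'
          map_zero' := by ext x; simp [mulAux]
          map_add' := fun u u' => by ext x; simp [mulAux_add_right] }
      map_zero' := by ext u x; simp [mulAux_zero_left]
      map_add' := fun r r' => by ext u x; simp [mulAux_add_left] }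
    (fun a r u => by
      ext x
      simp [mulAux_smul (k := k) inferInstance])

variable {A U R} in
lemma mulHom_tmul (r r' : R) (u u' : U) :
    mulHom k A U R (r' ⊗ₜ u') (r ⊗ₜ u) = r • mulAux r' u' (comul (R := A) u) :=
  mulRightAux_tmul r r' u u'

instance : One (Smash k A U R) := ⟨tmul k 1 1⟩

/-- The product is determined by `(r # u) * (r' # u') = r * (u₍₁₎ • r') # u₍₂₎ * u'`. -/
instance : Mul (Smash k A U R) := ⟨fun x y => mulHom k A U R y x⟩

variable {A U R} in
lemma tmul_mul_tmul (r r' : R) (u u' : U) :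
    @Eq (Smash k A U R) (tmul k r u * tmul k r' u') (r • mulAux r' u' (comul (R := A) u)) :=
  mulHom_tmul k r r' u u'

variable {k A U R} in
@[elab_as_elim]
lemma induction {p : Smash k A U R → Prop} (x : Smash k A U R) (zero : p 0)
    (tmul : ∀ r u, p (tmul k r u)) (add : ∀ x y, p x → p y → p (x + y)) : p x :=
  TensorProduct.induction_on x zero tmul add

variable {k A U R} in
protected lemma add_mul' (x y z : Smash k A U R) : (x + y) * z = x * z + y * z :=
  map_add (mulHom k A U R z) x y

variable {k A U R} in
protected lemma mul_add' (x y z : Smash k A U R) : x * (y + z) = x * y + x * z :=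
  LinearMap.congr_fun (map_add (mulHom k A U R) y z) x

variable {k A U R} in
protected lemma zero_mul' (x : Smash k A U R) : 0 * x = 0 := map_zero (mulHom k A U R x)

variable {k A U R} in
protected lemma mul_zero' (x : Smash k A U R) : x * 0 = 0 :=
  LinearMap.congr_fun (map_zero (mulHom k A U R)) x

variable {k A U R} in
protected lemma smul_mul' (r : R) (x y : Smash k A U R) : (r • x) * y = r • (x * y) :=
  map_smul (mulHom k A U R y) r x

variable [IsModuleAlgebra k A U R]

variable {k A U R} in
protected lemma one_mul' (x : Smash k A U R) : 1 * x = x := by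
  induction x using Smash.induction with
  | zero => exact Smash.mul_zero' _
  | tmul r u =>
    change tmul k 1 1 * _ = _
    rw [tmul_mul_tmul, IsCocommLeftBialgebroid.comul_one k, one_smul, mulAux_tmul, one_smul,
      one_mul]
    rfl
  | add x y hx hy => rw [Smash.mul_add', hx, hy]

variable {k A U R} in
protected lemma mul_one' (x : Smash k A U R) : x * 1 = x := by
  induction x using Smash.induction with
  | zero => exact Smash.zero_mul' _
  | tmul r u =>
    change _ * tmul k 1 1 = _
    have h : mulAux (A := A) (1 : R) (1 : U) =
        ((Algebra.linearMap A R).rTensor U) ∘ₗ (counit (R := A) (A := U)).rTensor U := by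
      ext x y
      simp [IsModuleAlgebra.smul_one (k := k) (A := A) x, source, Algebra.algebraMap_eq_smul_one]
    have h' := LinearMap.congr_fun
      (IsCocommLeftBialgebroid.rTensor_counit_comp_comul (k := k) (A := A) (U := U)) u
    rw [LinearMap.comp_apply] at h'
    rw [tmul_mul_tmul, h, LinearMap.comp_apply, h']
    simp [tmul, TensorProduct.smul_tmul']
    rfl
  | add x y hx hy => rw [Smash.add_mul', hx, hy]

variable {k A U R} in
/-- Auxiliary map for associativity:
`x ⊗ y ⊗ z ↦ (x • r') * (y * v • r'') ⊗ z * v' * u''` for `p = v ⊗ v'`. -/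
def assocAux (r' r'' : R) (u'' : U) (p : U ⊗[k] U) : U ⊗[A] (U ⊗[A] U) →ₗ[A] R ⊗[A] U :=
  (LinearMap.liftBaseChange R (LinearMap.id (R := A) (M := R ⊗[A] U))).restrictScalars A ∘ₗ
    TensorProduct.map (orbitMap A U R r') (mulAux r'' u'' ∘ₗ factorwiseMul k A U p)

variable {k A U R} in
lemma assocAux_tmul (r' r'' : R) (u'' : U) (p : U ⊗[k] U) (x : U) (t : U ⊗[A] U) :
    assocAux r' r'' u'' p (x ⊗ₜ t) = (x • r') • mulAux r'' u'' (factorwiseMul k A U p t) := by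
  simp [assocAux, orbitMap]

variable {k A U R} in
lemma assocAux_add (r' r'' : R) (u'' : U) (p q : U ⊗[k] U) :
    assocAux (A := A) r' r'' u'' (p + q) = assocAux r' r'' u'' p + assocAux r' r'' u'' q := by
  refine TensorProduct.ext' fun x t => ?_
  rw [LinearMap.add_apply, assocAux_tmul, assocAux_tmul, assocAux_tmul, map_add,
    LinearMap.add_apply, map_add, smul_add]

variable {k A U R} in
lemma assocAux_zero (r' r'' : R) (u'' : U) :
    assocAux (A := A) r' r'' u'' (0 : U ⊗[k] U) = 0 := by
  refine TensorProduct.ext' fun x t => ?_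
  rw [assocAux_tmul, map_zero, LinearMap.zero_apply, LinearMap.zero_apply, map_zero, smul_zero]

variable {k A U R} in
lemma mulHom_mulAux (r' r'' : R) (u' u'' : U) (p : U ⊗[k] U)
    (hp : proj k A U p = comul (R := A) u') (t : U ⊗[A] U) :
    mulHom k A U R (r'' ⊗ₜ u'') (mulAux r' u' t) =
      assocAux r' r'' u'' p (comul.lTensor U t) := by
  induction t with
  | zero => simp
  | tmul x y =>
    rw [mulAux_tmul, mulHom_tmul, LinearMap.lTensor_tmul, assocAux_tmul,
      IsCocommLeftBialgebroid.comul_mul y u' p hp]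
  | add x y hx hy => simp only [map_add, hx, hy]

variable {k A U R} in
lemma mulAux_mul_smul (r' r'' : R) (u'' v v' : U) (t : U ⊗[A] U) :
    mulAux (A := A) (r' * v • r'') (v' * u'') t =
      assocAux r' r'' u'' (v ⊗ₜ[k] v') (TensorProduct.assoc A U U U (comul.rTensor U t)) := by
  induction t with
  | zero => simp
  | tmul x y =>
    rw [mulAux_tmul, LinearMap.rTensor_tmul, IsModuleAlgebra.smul_mul (k := k) (A := A)]
    generalize comul (R := A) x = s
    induction s with
    | zero => simp
    | tmul a b =>
      simp [assocAux_tmul, orbitMap, mul_smul, mul_assoc, TensorProduct.smul_tmul']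
    | add a b ha hb => simp only [map_add, TensorProduct.add_tmul, ha, hb]
  | add x y hx hy => simp only [map_add, hx, hy]

variable {k A U R} in
lemma mulHom_smul_mulAux (r r' r'' : R) (u u'' : U) (p : U ⊗[k] U) :
    mulHom k A U R (r' • mulAux r'' u'' (proj k A U p)) (r ⊗ₜ u) =
      r • assocAux r' r'' u'' p
        (TensorProduct.assoc A U U U (comul.rTensor U (comul (R := A) u))) := by
  induction p with
  | zero => simp [assocAux_zero]
  | tmul v v' =>
    rw [proj_tmul, mulAux_tmul, TensorProduct.smul_tmul', mulHom_tmul, smul_eq_mul,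
      mulAux_mul_smul (k := k)]
  | add x y hx hy => simp only [map_add, smul_add, LinearMap.add_apply, hx, hy, assocAux_add]

variable {k A U R} in
protected lemma mul_assoc' (x y z : Smash k A U R) : x * y * z = x * (y * z) := by
  induction x using Smash.induction with
  | zero => simp only [Smash.zero_mul']
  | add x x' hx hx' => simp only [Smash.add_mul', hx, hx']
  | tmul r u =>
    induction y using Smash.induction with
    | zero => simp only [Smash.zero_mul', Smash.mul_zero']
    | add y y' hy hy' => simp only [Smash.add_mul', Smash.mul_add', hy, hy']
    | tmul r' u' =>
      induction z using Smash.induction with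
      | zero => simp only [Smash.mul_zero']
      | add z z' hz hz' => simp only [Smash.mul_add', hz, hz']
      | tmul r'' u'' =>
        obtain ⟨p, hp⟩ := proj_surjective k A U (comul (R := A) u')
        change mulHom k A U R (r'' ⊗ₜ u'') (mulHom k A U R (r' ⊗ₜ u') (r ⊗ₜ u)) =
          mulHom k A U R (mulHom k A U R (r'' ⊗ₜ u'') (r' ⊗ₜ u')) (r ⊗ₜ u)
        have h := LinearMap.congr_fun
          (IsCocommLeftBialgebroid.coassoc (k := k) (A := A) (U := U)) u
        simp only [LinearMap.comp_apply, LinearEquiv.coe_coe] at h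
        rw [mulHom_tmul, mulHom_tmul, map_smul, mulHom_mulAux r' r'' u' u'' p hp, ← hp,
          mulHom_smul_mulAux, h]

instance : Ring (Smash k A U R) where
  __ := (inferInstance : AddCommGroup (Smash k A U R))
  mul_assoc := Smash.mul_assoc'
  one_mul := Smash.one_mul'
  mul_one := Smash.mul_one'
  left_distrib := Smash.mul_add'
  right_distrib := Smash.add_mul'
  zero_mul := Smash.zero_mul'
  mul_zero := Smash.mul_zero'

instance : IsScalarTower R (Smash k A U R) (Smash k A U R) := ⟨Smash.smul_mul'⟩

variable {k A U R} in
protected lemma mul_smul' (c : k) (x y : Smash k A U R) : x * (c • y) = c • (x * y) := by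
  induction x using Smash.induction with
  | zero => simp only [zero_mul, smul_zero]
  | add x x' hx hx' => simp only [add_mul, smul_add, hx, hx']
  | tmul r u =>
    induction y using Smash.induction with
    | zero => simp only [smul_zero, mul_zero]
    | add y y' hy hy' => simp only [mul_add, smul_add, hy, hy']
    | tmul r' u' =>
      have h : c • (tmul k r' u' : Smash k A U R) = tmul k (algebraMap k A c • r') u' := by
        rw [algebraMap_smul]; rfl
      have h' : mulAux (A := A) (algebraMap k A c • r') u' =
          algebraMap k A c • mulAux (A := A) r' u' := by
        have hk (r : R) : c • r = (c • (1 : U)) • r := by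
          rw [← algebraMap_smul A c (1 : U), smul_assoc, one_smul, algebraMap_smul]
        ext x y
        simp [hk, TensorProduct.smul_tmul', ← mul_smul]
      rw [h, tmul_mul_tmul, tmul_mul_tmul, h', LinearMap.smul_apply, algebraMap_smul]
      exact smul_comm r c (mulAux r' u' (comul (R := A) u))

instance : Algebra k (Smash k A U R) :=
  Algebra.ofModule (fun c x y => by
    rw [← algebraMap_smul R c x, smul_mul_assoc, algebraMap_smul]) Smash.mul_smul'

/-- The coproduct `R ⊗ U → R ⊗ (U ⊗ U) ≃ (R ⊗ U) ⊗ (R ⊗ U)` and the counit `R ⊗ U → R ⊗ A ≃ R`. -/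
instance : CoalgebraStruct R (Smash k A U R) where
  comul := (TensorProduct.AlgebraTensorModule.distribBaseChange A R U U).toLinearMap ∘ₗ
    (comul (R := A) (A := U)).baseChange R
  counit := (TensorProduct.AlgebraTensorModule.rid A R R).toLinearMap ∘ₗ
    (counit (R := A) (A := U)).baseChange R

end Smash
end ModuleAlgebra
end LeftBialgebroid

/-! ### The universal enveloping algebra of a Lie-Rinehart algebra -/

namespace LieRinehartAlgebra

section Enveloping

variable (k A h : Type*) [CommRing k] [CommRing A] [Algebra k A] [LieRing h] [LieAlgebra k h]
  [Module A h] [LieRingModule h A]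

/-- The defining relations of the universal enveloping algebra on the tensor algebra of the
`k`-module `A × h`.  The anchor applied to `X` and `a` is `⁅X, a⁆`. -/
inductive EnvelopingRel : TensorAlgebra k (A × h) → TensorAlgebra k (A × h) → Prop
  | one : EnvelopingRel (TensorAlgebra.ι k (1, 0)) 1
  | mul (a b : A) : EnvelopingRel (TensorAlgebra.ι k (a * b, 0))
      (TensorAlgebra.ι k (a, 0) * TensorAlgebra.ι k (b, 0))
  | lie (X Y : h) : EnvelopingRel (TensorAlgebra.ι k (0, ⁅X, Y⁆))
      (TensorAlgebra.ι k (0, X) * TensorAlgebra.ι k (0, Y) -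
        TensorAlgebra.ι k (0, Y) * TensorAlgebra.ι k (0, X))
  | smul (a : A) (X : h) : EnvelopingRel (TensorAlgebra.ι k (0, a • X))
      (TensorAlgebra.ι k (a, 0) * TensorAlgebra.ι k (0, X))
  | anchor (X : h) (a : A) : EnvelopingRel
      (TensorAlgebra.ι k (0, X) * TensorAlgebra.ι k (a, 0) -
        TensorAlgebra.ι k (a, 0) * TensorAlgebra.ι k (0, X))
      (TensorAlgebra.ι k (⁅X, a⁆, 0))

/-- The universal enveloping algebra of the Lie-Rinehart algebra `(A, h)`. -/
def Enveloping : Type _ := RingQuot (EnvelopingRel k A h)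

namespace Enveloping

instance : Ring (Enveloping k A h) := inferInstanceAs (Ring (RingQuot (EnvelopingRel k A h)))

instance : Algebra k (Enveloping k A h) :=
  inferInstanceAs (Algebra k (RingQuot (EnvelopingRel k A h)))

/-- The projection from the tensor algebra. -/
def mk : TensorAlgebra k (A × h) →ₐ[k] Enveloping k A h :=
  RingQuot.mkAlgHom k (EnvelopingRel k A h)

variable {k A h} in
lemma mk_eq {x y : TensorAlgebra k (A × h)} (hxy : EnvelopingRel k A h x y) :
    mk k A h x = mk k A h y := RingQuot.mkAlgHom_rel k hxy

/-- The canonical morphism of `k`-algebras `A → U_A(h)`. -/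
def ιA : A →ₐ[k] Enveloping k A h :=
  AlgHom.ofLinearMap (mk k A h ∘ₗ TensorAlgebra.ι k ∘ₗ LinearMap.inl k A h)
    ((mk_eq .one).trans (map_one _)) (fun a b => (mk_eq (.mul a b)).trans (map_mul _ _ _))

/-- The canonical `k`-linear map `h → U_A(h)`; it is a morphism of Lie algebras by `ιL_lie`. -/
def ιL : h →ₗ[k] Enveloping k A h :=
  (mk k A h).toLinearMap ∘ₗ TensorAlgebra.ι k ∘ₗ LinearMap.inr k A h

variable {k A h}

lemma ιL_lie (X Y : h) :
    ιL k A h ⁅X, Y⁆ = ιL k A h X * ιL k A h Y - ιL k A h Y * ιL k A h X :=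
  (mk_eq (.lie X Y)).trans (by rw [map_sub, map_mul, map_mul]; rfl)

lemma ιL_smul (a : A) (X : h) : ιL k A h (a • X) = ιA k A h a * ιL k A h X :=
  (mk_eq (.smul a X)).trans (map_mul _ _ _)

lemma ιL_mul_ιA (X : h) (a : A) :
    ιL k A h X * ιA k A h a - ιA k A h a * ιL k A h X = ιA k A h ⁅X, a⁆ :=
  Eq.trans (by rw [map_sub, map_mul, map_mul]; rfl) (mk_eq (.anchor X a))

section Lift

variable {B : Type*} [Ring B] [Algebra k B]

/-- The universal property: a morphism of `k`-algebras `A → B` and a morphism of Lie algebras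
`h → B` which are compatible extend to the enveloping algebra. -/
def lift (fA : A →ₐ[k] B) (fL : h →ₗ[k] B)
    (lie : ∀ X Y, fL ⁅X, Y⁆ = fL X * fL Y - fL Y * fL X)
    (smul : ∀ (a : A) X, fL (a • X) = fA a * fL X)
    (anchor : ∀ X (a : A), fL X * fA a - fA a * fL X = fA ⁅X, a⁆) :
    Enveloping k A h →ₐ[k] B :=
  RingQuot.liftAlgHom k
    ⟨TensorAlgebra.lift k (fA.toLinearMap.coprod fL), fun x y hxy => by
      cases hxy <;> simp [lie, smul, anchor]⟩

variable (fA : A →ₐ[k] B) (fL : h →ₗ[k] B)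
    (lie : ∀ X Y, fL ⁅X, Y⁆ = fL X * fL Y - fL Y * fL X)
    (smul : ∀ (a : A) X, fL (a • X) = fA a * fL X)
    (anchor : ∀ X (a : A), fL X * fA a - fA a * fL X = fA ⁅X, a⁆)

@[simp] lemma lift_ιA (a : A) : lift fA fL lie smul anchor (ιA k A h a) = fA a := by
  change RingQuot.liftAlgHom k _ (RingQuot.mkAlgHom k _ (TensorAlgebra.ι k (a, 0))) = _
  simp

@[simp] lemma lift_ιL (X : h) : lift fA fL lie smul anchor (ιL k A h X) = fL X := by
  change RingQuot.liftAlgHom k _ (RingQuot.mkAlgHom k _ (TensorAlgebra.ι k (0, X))) = _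
  simp

/-- Morphisms out of the enveloping algebra are determined on `A` and `h`. -/
lemma hom_ext {f g : Enveloping k A h →ₐ[k] B} (hA : ∀ a, f (ιA k A h a) = g (ιA k A h a))
    (hL : ∀ X, f (ιL k A h X) = g (ιL k A h X)) : f = g := by
  refine RingQuot.ringQuot_ext' k f g (TensorAlgebra.hom_ext ?_)
  refine LinearMap.prod_ext (LinearMap.ext hA) (LinearMap.ext hL)

end Lift

/-- The left `A`-module structure `a • u = ιA a * u`. -/
instance : Module A (Enveloping k A h) := Module.compHom _ (ιA k A h).toRingHom

lemma smul_def (a : A) (u : Enveloping k A h) : a • u = ιA k A h a * u := rfl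

instance : IsScalarTower k A (Enveloping k A h) :=
  ⟨fun c a u => by rw [smul_def, smul_def, map_smul, smul_mul_assoc]⟩

instance : IsScalarTower A (Enveloping k A h) (Enveloping k A h) :=
  ⟨fun _ _ _ => mul_assoc _ _ _⟩

end Enveloping

end Enveloping

/-! ### Lie-Rinehart algebras acting by derivations -/

/-- The compatibilities of an action of the Lie-Rinehart algebra `(A, h)` by derivations on the
commutative `A`-algebra `R`.  The action `ρ X r` is written `⁅X, r⁆`; together with
`LieModule k h R` this says that `ρ : h → Der_k(R)` is a morphism of Lie algebras, that the
structure map `η : A → R` intertwines the anchor with `ρ`, and that `ρ (a • X) = η a • ρ X`. -/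
class IsDerivationAction (A h R : Type*) [CommRing A] [LieRing h] [Module A h] [LieRingModule h A]
    [CommRing R] [Algebra A R] [LieRingModule h R] : Prop where
  lie_mul (X : h) (r s : R) : ⁅X, r * s⁆ = r * ⁅X, s⁆ + ⁅X, r⁆ * s
  lie_algebraMap (X : h) (a : A) : ⁅X, algebraMap A R a⁆ = algebraMap A R ⁅X, a⁆
  smul_lie (a : A) (X : h) (r : R) : ⁅a • X, r⁆ = algebraMap A R a * ⁅X, r⁆

/-- A Lie-Rinehart algebra `(A, h)` acts on `A` through its anchor. -/
instance (A h : Type*) [CommRing A] [LieRing h] [Module A h] [LieRingModule h A]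
    [LieRinehartRing A h] : IsDerivationAction A h A where
  lie_mul X r s := LieRinehartRing.leibniz_mul_right X r s
  lie_algebraMap _ _ := rfl
  smul_lie a X r := LieRinehartRing.lie_smul_eq_mul a r X

section Action

variable (k A h R : Type*) [CommRing k] [CommRing A] [Algebra k A] [LieRing h] [LieAlgebra k h]
  [Module A h] [LieRingModule h A]
  [CommRing R] [Algebra k R] [Algebra A R] [IsScalarTower k A R] [LieRingModule h R]
  [LieModule k h R] [IsDerivationAction A h R]

namespace Enveloping

/-- The action of `h` on `R` as a `k`-linear map `h → End_k(R)`. -/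
def lieEnd : h →ₗ[k] Module.End k R :=
  LinearMap.mk₂ k (fun X r => ⁅X, r⁆) add_lie smul_lie lie_add lie_smul

@[simp] lemma lieEnd_apply (X : h) (r : R) : lieEnd k h R X r = ⁅X, r⁆ := rfl

/-- The action of the enveloping algebra on `R`, determined by `ιA a ↦ (r ↦ a • r)` and
`ιL X ↦ (r ↦ ⁅X, r⁆)`. -/
def toEnd : Enveloping k A h →ₐ[k] Module.End k R :=
  lift (Algebra.lsmul k k R) (lieEnd k h R)
    (fun X Y => by ext r; simp)
    (fun a X => by
      ext r; simp [IsDerivationAction.smul_lie, Algebra.smul_def])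
    (fun X a => by
      ext r
      simp [Algebra.smul_def, IsDerivationAction.lie_mul (A := A),
        IsDerivationAction.lie_algebraMap])

instance : Module (Enveloping k A h) R := Module.compHom R (toEnd k A h R).toRingHom

variable {k A h R}

lemma ιA_smul (a : A) (r : R) : ιA k A h a • r = a • r :=
  LinearMap.congr_fun (lift_ιA (B := Module.End k R) _ _ _ _ _ a) r

lemma ιL_smul_eq (X : h) (r : R) : ιL k A h X • r = ⁅X, r⁆ :=
  LinearMap.congr_fun (lift_ιL (B := Module.End k R) _ _ _ _ _ X) r

instance : IsScalarTower A (Enveloping k A h) R :=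
  ⟨fun a u r => by rw [smul_def, mul_smul, ιA_smul]⟩

end Enveloping

end Action

namespace Enveloping

/-! #### The coproduct and the counit of the enveloping algebra -/

section Comul

variable (k A h : Type*) [CommRing k] [CommRing A] [Algebra k A] [LieRing h] [LieAlgebra k h]
  [Module A h] [LieRingModule h A]

/-- The diagonal action of `X` on `U ⊗[A] U` for `U = U_A(h)`: `u ⊗ v ↦ X * u ⊗ v + u ⊗ X * v`. -/
def diagLie (X : h) : Module.End k (Enveloping k A h ⊗[A] Enveloping k A h) where
  toFun := TensorProduct.liftAddHom
    { toFun := fun u =>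
        { toFun := fun v => (ιL k A h X * u) ⊗ₜ[A] v + u ⊗ₜ[A] (ιL k A h X * v)
          map_zero' := by simp
          map_add' := fun v v' => by simp only [mul_add, TensorProduct.tmul_add]; abel }
      map_zero' := by ext v; simp
      map_add' := fun u u' => by
        ext v
        simp only [mul_add, TensorProduct.add_tmul, AddMonoidHom.coe_mk, ZeroHom.coe_mk,
          AddMonoidHom.add_apply]
        abel }
    (fun a u v => by
      have key (w : Enveloping k A h) : ιL k A h X * (a • w) = a • (ιL k A h X * w) + ⁅X, a⁆ • w := by
        rw [smul_def, smul_def, smul_def, ← mul_assoc, ← ιL_mul_ιA, sub_mul, mul_assoc, mul_assoc]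
        abel
      simp only [AddMonoidHom.coe_mk, ZeroHom.coe_mk, key, TensorProduct.add_tmul,
        TensorProduct.tmul_add, TensorProduct.smul_tmul]
      abel)
  map_add' := map_add _
  map_smul' c t := by
    induction t with
    | zero => simp
    | tmul u v =>
      simp [TensorProduct.smul_tmul', TensorProduct.liftAddHom_tmul]
    | add x y hx hy => simp only [smul_add, map_add, hx, hy]

variable {k A h} in
@[simp] lemma diagLie_tmul (X : h) (u v : Enveloping k A h) : diagLie k A h X (u ⊗ₜ[A] v) =
    (ιL k A h X * u) ⊗ₜ[A] v + u ⊗ₜ[A] (ιL k A h X * v) := rfl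

/-- The diagonal action of the enveloping algebra on `U ⊗[A] U` for `U = U_A(h)`: `a` acts by scalar
multiplication and `X` by `u ⊗ v ↦ X * u ⊗ v + u ⊗ X * v`. -/
def diag : Enveloping k A h →ₐ[k] Module.End k (Enveloping k A h ⊗[A] Enveloping k A h) :=
  lift (Algebra.lsmul k k (Enveloping k A h ⊗[A] Enveloping k A h))
    { toFun := diagLie k A h
      map_add' := fun X Y => LinearMap.ext fun t => by
        induction t with
        | zero => simp
        | tmul u v => simp [add_mul, TensorProduct.add_tmul, TensorProduct.tmul_add]; abel
        | add x y hx hy => simp only [map_add, hx, hy]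
      map_smul' := fun c X => LinearMap.ext fun t => by
        induction t with
        | zero => simp
        | tmul u v => simp [TensorProduct.smul_tmul']
        | add x y hx hy => simp only [map_add, hx, hy] }
    (fun X Y => LinearMap.ext fun t => by
      induction t with
      | zero => simp
      | tmul u v =>
        simp [ιL_lie, sub_mul, TensorProduct.sub_tmul, TensorProduct.tmul_sub, mul_assoc]
        abel
      | add x y hx hy => simp only [map_add, hx, hy])
    (fun a X => LinearMap.ext fun t => by
      induction t with
      | zero => simp
      | tmul u v =>
        simp only [ιL_smul, LinearMap.coe_mk, AddHom.coe_mk, diagLie_tmul, Module.End.mul_apply,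
          Algebra.lsmul_coe, smul_add, TensorProduct.smul_tmul', smul_def, mul_assoc]
        congr 1
        exact (TensorProduct.smul_tmul a u (ιL k A h X * v)).symm
      | add x y hx hy => simp only [map_add, hx, hy])
    (fun X a => LinearMap.ext fun t => by
      induction t with
      | zero => simp
      | tmul u v =>
        simp [TensorProduct.smul_tmul', smul_def, ← ιL_mul_ιA, sub_mul, mul_assoc,
          TensorProduct.sub_tmul]
      | add x y hx hy => simp only [map_add, hx, hy])

variable [LieRinehartRing A h] [LieRinehartAlgebra k A h]

/-- The coproduct `Δ u = u · (1 ⊗ 1)` (diagonal action) and the counit `ε u = u · 1` (action on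
`A` through the anchor), so that `Δ X = X ⊗ 1 + 1 ⊗ X` and `ε X = 0` for `X` in `h`. -/
instance : CoalgebraStruct A (Enveloping k A h) where
  comul :=
    { toFun := fun u => diag k A h u (1 ⊗ₜ[A] 1)
      map_add' := fun u v => by simp
      map_smul' := fun a u => by simp [smul_def, diag] }
  counit :=
    { toFun := fun u => u • (1 : A)
      map_add' := fun u v => add_smul u v 1
      map_smul' := fun a u => smul_assoc a u (1 : A) }

variable {k A h}

lemma comul_ιA (a : A) : CoalgebraStruct.comul (R := A) (ιA k A h a) = ιA k A h a ⊗ₜ[A] 1 := by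
  change diag k A h (ιA k A h a) (1 ⊗ₜ[A] 1) = _
  simp [diag, TensorProduct.smul_tmul', smul_def]

lemma comul_ιL (X : h) : CoalgebraStruct.comul (R := A) (ιL k A h X) =
    ιL k A h X ⊗ₜ[A] 1 + 1 ⊗ₜ[A] ιL k A h X := by
  change diag k A h (ιL k A h X) (1 ⊗ₜ[A] 1) = _
  simp [diag]

lemma counit_ιA (a : A) : CoalgebraStruct.counit (R := A) (ιA k A h a) = a :=
  (ιA_smul a (1 : A)).trans (mul_one a)

lemma counit_ιL (X : h) : CoalgebraStruct.counit (R := A) (ιL k A h X) = 0 := by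
  have h1 := (LieRinehartAlgebra.anchor k A h X).map_one_eq_zero
  exact (ιL_smul_eq X (1 : A)).trans h1

end Comul

end Enveloping

end LieRinehartAlgebra

/-! ### The Lie-Rinehart algebra `R ⋊ h` -/

namespace LieRinehartAlgebra

section BaseChange

set_option linter.unusedSectionVars false

/-- The `R`-module `R ⊗[A] h`, to be endowed with the structure of a Lie-Rinehart algebra over `R`
determined by an action of `(A, h)` on `R` by derivations. -/
def BaseChange (A h R : Type*) [CommRing A] [LieRing h] [Module A h] [CommRing R] [Algebra A R] :
    Type _ := R ⊗[A] h

variable (k A h R : Type*) [CommRing k] [CommRing A] [Algebra k A] [LieRing h] [LieAlgebra k h]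
  [Module A h] [LieRingModule h A] [CommRing R] [Algebra k R] [Algebra A R] [IsScalarTower k A R]

namespace BaseChange

instance : AddCommGroup (BaseChange A h R) := inferInstanceAs (AddCommGroup (R ⊗[A] h))

instance : Module R (BaseChange A h R) := inferInstanceAs (Module R (R ⊗[A] h))

instance : Module k (BaseChange A h R) := inferInstanceAs (Module k (R ⊗[A] h))

instance : IsScalarTower k R (BaseChange A h R) := inferInstanceAs (IsScalarTower k R (R ⊗[A] h))

variable {A h R} in
/-- The element `r ⊗ X`. -/
def tmul (r : R) (X : h) : BaseChange A h R := r ⊗ₜ[A] X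

variable {A h R} in
@[elab_as_elim]
lemma induction {p : BaseChange A h R → Prop} (x : BaseChange A h R) (zero : p 0)
    (tmul : ∀ r X, p (tmul r X)) (add : ∀ x y, p x → p y → p (x + y)) : p x :=
  TensorProduct.induction_on x zero tmul add

variable {A h R} in
lemma addHom_ext {P : Type*} [AddCommGroup P] {f g : R ⊗[A] h →+ P}
    (hfg : ∀ (r : R) (X : h), f (r ⊗ₜ X) = g (r ⊗ₜ X)) : f = g :=
  AddMonoidHom.ext fun x => by
    induction x with
    | zero => simp
    | tmul r X => exact hfg r X
    | add x y hx hy => simp only [map_add, hx, hy]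

variable {A h R} in
lemma add_tmul (r s : R) (X : h) : (tmul (r + s) X : BaseChange A h R) = tmul r X + tmul s X :=
  TensorProduct.add_tmul r s X

variable {A h R} in
lemma tmul_add (r : R) (X Y : h) : (tmul r (X + Y) : BaseChange A h R) = tmul r X + tmul r Y :=
  TensorProduct.tmul_add r X Y

variable {A h R} in
lemma neg_tmul (r : R) (X : h) : (tmul (-r) X : BaseChange A h R) = - tmul r X :=
  TensorProduct.neg_tmul r X

variable {A h R} in
lemma tmul_neg (r : R) (X : h) : (tmul r (-X) : BaseChange A h R) = - tmul r X :=
  TensorProduct.tmul_neg r X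

variable {A h R} in
lemma sub_tmul (r s : R) (X : h) : (tmul (r - s) X : BaseChange A h R) = tmul r X - tmul s X :=
  TensorProduct.sub_tmul r s X

variable {A h R} in
lemma tmul_zero (r : R) : (tmul r 0 : BaseChange A h R) = 0 :=
  TensorProduct.tmul_zero _ r

variable {A h R} in
lemma zero_tmul (X : h) : (tmul 0 X : BaseChange A h R) = 0 :=
  TensorProduct.zero_tmul _ X

variable {A h R} in
lemma tmul_smul (a : A) (r : R) (X : h) :
    (tmul r (a • X) : BaseChange A h R) = tmul (algebraMap A R a * r) X := by
  rw [← Algebra.smul_def]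
  exact (TensorProduct.smul_tmul a r X).symm

variable {A h R} in
lemma smul_tmul (s r : R) (X : h) : s • (tmul r X : BaseChange A h R) = tmul (s * r) X := rfl

variable {A h R} in
lemma smul_tmul' (c : k) (r : R) (X : h) : c • (tmul r X : BaseChange A h R) = tmul (c • r) X :=
  rfl

variable [LieRinehartRing A h] [LieRingModule h R] [IsDerivationAction A h R]

variable {A h R} in
/-- The bracket with a pure tensor on the left, as an additive map. -/
def bracketAux (r : R) (X : h) : R ⊗[A] h →+ BaseChange A h R :=
  TensorProduct.liftAddHom
    { toFun := fun s =>
        { toFun := fun Y => tmul (r * s) ⁅X, Y⁆ - tmul (s * ⁅Y, r⁆) X + tmul (r * ⁅X, s⁆) Y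
          map_zero' := by simp [zero_tmul, tmul_zero]
          map_add' := fun Y Z => by
            simp only [lie_add, add_lie, mul_add, tmul_add, add_tmul]; abel }
      map_zero' := by ext Y; simp [zero_tmul]
      map_add' := fun s t => by
        ext Y
        simp only [lie_add, mul_add, add_mul, add_tmul, AddMonoidHom.coe_mk,
          ZeroHom.coe_mk, AddMonoidHom.add_apply]
        abel }
    (fun a s Y => by
      simp only [AddMonoidHom.coe_mk, ZeroHom.coe_mk, LieRinehartRing.leibniz_smul_right, tmul_add,
        tmul_smul, IsDerivationAction.smul_lie, Algebra.smul_def,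
        IsDerivationAction.lie_mul (A := A) (h := h) (R := R), mul_add, add_tmul,
        IsDerivationAction.lie_algebraMap]
      ring_nf
      abel)

variable {A h R} in
lemma bracketAux_tmul (r s : R) (X Y : h) : bracketAux (A := A) r X (s ⊗ₜ Y) =
    tmul (r * s) ⁅X, Y⁆ - tmul (s * ⁅Y, r⁆) X + tmul (r * ⁅X, s⁆) Y := rfl

/-- The bracket as a biadditive map. -/
def bracketHom : R ⊗[A] h →+ R ⊗[A] h →+ BaseChange A h R :=
  TensorProduct.liftAddHom
    { toFun := fun r =>
        { toFun := fun X => bracketAux r X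
          map_zero' := by
            refine addHom_ext fun s Y => ?_
            rw [bracketAux_tmul]; simp [tmul_zero, zero_tmul]
          map_add' := fun X Y => by
            refine addHom_ext fun s Z => ?_
            simp only [bracketAux_tmul, AddMonoidHom.add_apply, add_lie, tmul_add, mul_add,
              add_tmul]
            abel }
      map_zero' := by
        ext X : 1
        refine addHom_ext fun s Y => ?_
        simp [bracketAux_tmul, zero_tmul]
      map_add' := fun r r' => by
        ext X : 1
        refine addHom_ext fun s Z => ?_
        simp only [bracketAux_tmul, AddMonoidHom.add_apply, AddMonoidHom.coe_mk, ZeroHom.coe_mk,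
          lie_add, add_mul, mul_add, add_tmul]
        abel }
    (fun a r X => by
      refine addHom_ext fun s Y => ?_
      have h1 : ⁅a • X, Y⁆ = a • ⁅X, Y⁆ - ⁅Y, a⁆ • X := by
        rw [← lie_skew, LieRinehartRing.leibniz_smul_right, neg_add, ← smul_neg, lie_skew,
          sub_eq_add_neg]
      simp only [bracketAux_tmul, AddMonoidHom.coe_mk, ZeroHom.coe_mk, h1, sub_eq_add_neg,
        tmul_add, tmul_neg, tmul_smul, IsDerivationAction.smul_lie, Algebra.smul_def,
        IsDerivationAction.lie_mul (A := A) (h := h) (R := R), mul_add, add_tmul,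
        IsDerivationAction.lie_algebraMap]
      ring_nf
      abel)

/-- The bracket `[r ⊗ X, s ⊗ Y] = rs ⊗ [X, Y] - s ρ(Y)(r) ⊗ X + r ρ(X)(s) ⊗ Y`. -/
instance : Bracket (BaseChange A h R) (BaseChange A h R) := ⟨fun x y => bracketHom A h R x y⟩

variable {A h R} in
lemma lie_tmul_tmul (r s : R) (X Y : h) : 
    ⁅(tmul r X : BaseChange A h R), (tmul s Y : BaseChange A h R)⁆ =
      tmul (r * s) ⁅X, Y⁆ - tmul (s * ⁅Y, r⁆) X + tmul (r * ⁅X, s⁆) Y := rfl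

/-- The anchor as a biadditive map. -/
def anchorHom : R ⊗[A] h →+ R →+ R :=
  TensorProduct.liftAddHom
    { toFun := fun r =>
        { toFun := fun X =>
            { toFun := fun s => r * ⁅X, s⁆
              map_zero' := by simp
              map_add' := fun s t => by simp [mul_add] }
          map_zero' := by ext; simp
          map_add' := fun X Y => by ext; simp [mul_add] }
      map_zero' := by ext; simp
      map_add' := fun r r' => by ext; simp [add_mul] }
    (fun a r X => by
      ext s
      simp [IsDerivationAction.smul_lie, Algebra.smul_def, mul_assoc, mul_left_comm])

/-- The anchor `(r ⊗ X)(s) = r ρ(X)(s)`. -/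
instance : Bracket (BaseChange A h R) R := ⟨fun x s => anchorHom A h R x s⟩

variable {A h R} in
lemma tmul_lie (r s : R) (X : h) : ⁅(tmul r X : BaseChange A h R), s⁆ = r * ⁅X, s⁆ := rfl

variable {A h R}

protected lemma add_lie' (x y z : BaseChange A h R) : ⁅x + y, z⁆ = ⁅x, z⁆ + ⁅y, z⁆ :=
  DFunLike.congr_fun (map_add (bracketHom A h R) x y) z

protected lemma lie_add' (x y z : BaseChange A h R) : ⁅x, y + z⁆ = ⁅x, y⁆ + ⁅x, z⁆ :=
  map_add (bracketHom A h R x) y z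

protected lemma zero_lie' (z : BaseChange A h R) : ⁅(0 : BaseChange A h R), z⁆ = 0 :=
  DFunLike.congr_fun (map_zero (bracketHom A h R)) z

protected lemma lie_zero' (z : BaseChange A h R) : ⁅z, (0 : BaseChange A h R)⁆ = 0 :=
  map_zero (bracketHom A h R z)

protected lemma add_lie_base (x y : BaseChange A h R) (s : R) : ⁅x + y, s⁆ = ⁅x, s⁆ + ⁅y, s⁆ :=
  DFunLike.congr_fun (map_add (anchorHom A h R) x y) s

protected lemma lie_base_add (x : BaseChange A h R) (s t : R) : ⁅x, s + t⁆ = ⁅x, s⁆ + ⁅x, t⁆ :=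
  map_add (anchorHom A h R x) s t

protected lemma zero_lie_base (s : R) : ⁅(0 : BaseChange A h R), s⁆ = 0 :=
  DFunLike.congr_fun (map_zero (anchorHom A h R)) s

protected lemma lie_base_zero (x : BaseChange A h R) : ⁅x, (0 : R)⁆ = 0 :=
  map_zero (anchorHom A h R x)

protected lemma lie_skew' (x y : BaseChange A h R) : ⁅x, y⁆ = -⁅y, x⁆ := by
  induction x using BaseChange.induction with
  | zero => rw [BaseChange.zero_lie', BaseChange.lie_zero', neg_zero]
  | add x x' hx hx' => rw [BaseChange.add_lie', BaseChange.lie_add', hx, hx']; abel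
  | tmul r X =>
    induction y using BaseChange.induction with
    | zero => rw [BaseChange.zero_lie', BaseChange.lie_zero', neg_zero]
    | add x x' hx hx' => rw [BaseChange.add_lie', BaseChange.lie_add', hx, hx']; abel
    | tmul s Y =>
      rw [lie_tmul_tmul, lie_tmul_tmul, ← lie_skew X Y, tmul_neg, mul_comm r s]
      abel

protected lemma lie_self' (x : BaseChange A h R) : ⁅x, x⁆ = 0 := by
  induction x using BaseChange.induction with
  | zero => rw [BaseChange.zero_lie']
  | add x y hx hy =>
    rw [BaseChange.add_lie', BaseChange.lie_add', BaseChange.lie_add', hx, hy,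
      BaseChange.lie_skew' x y]
    abel
  | tmul r X => rw [lie_tmul_tmul, lie_self, tmul_zero]; abel

protected lemma leibniz_lie' (x y z : BaseChange A h R) :
    ⁅x, ⁅y, z⁆⁆ = ⁅⁅x, y⁆, z⁆ + ⁅y, ⁅x, z⁆⁆ := by
  induction x using BaseChange.induction with
  | zero => simp only [BaseChange.zero_lie', BaseChange.lie_zero', add_zero]
  | add x x' hx hx' => simp only [BaseChange.add_lie', BaseChange.lie_add', hx, hx']; abel
  | tmul r X =>
    induction y using BaseChange.induction with
    | zero => simp only [BaseChange.zero_lie', BaseChange.lie_zero', add_zero]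
    | add x x' hx hx' => simp only [BaseChange.add_lie', BaseChange.lie_add', hx, hx']; abel
    | tmul s Y =>
      induction z using BaseChange.induction with
      | zero => simp only [BaseChange.lie_zero', add_zero]
      | add x x' hx hx' => simp only [BaseChange.lie_add', hx, hx']; abel
      | tmul t Z =>
        have hsub (x y z : BaseChange A h R) : ⁅x - y, z⁆ = ⁅x, z⁆ - ⁅y, z⁆ :=
          DFunLike.congr_fun (map_sub (bracketHom A h R) x y) z
        have hsub' (x y z : BaseChange A h R) : ⁅x, y - z⁆ = ⁅x, y⁆ - ⁅x, z⁆ :=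
          map_sub (bracketHom A h R x) y z
        simp only [lie_tmul_tmul, BaseChange.add_lie', BaseChange.lie_add', hsub, hsub',
          IsDerivationAction.lie_mul (A := A) (h := h) (R := R), mul_add, add_tmul, lie_lie,
          mul_sub, sub_tmul]
        rw [leibniz_lie X Y Z, tmul_add, ← lie_skew X Y]
        simp only [tmul_neg]
        ring_nf
        abel_nf

instance : LieRing (BaseChange A h R) where
  __ := (inferInstance : AddCommGroup (BaseChange A h R))
  add_lie := BaseChange.add_lie'
  lie_add := BaseChange.lie_add'
  lie_self := BaseChange.lie_self'
  leibniz_lie := BaseChange.leibniz_lie'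

instance : LieRingModule (BaseChange A h R) R where
  add_lie := BaseChange.add_lie_base
  lie_add := BaseChange.lie_base_add
  leibniz_lie x y s := by
    induction x using BaseChange.induction with
    | zero => simp only [BaseChange.zero_lie', BaseChange.zero_lie_base, BaseChange.lie_base_zero,
        add_zero]
    | add x x' hx hx' =>
      simp only [BaseChange.add_lie', BaseChange.add_lie_base, BaseChange.lie_base_add, hx, hx']
      abel
    | tmul r X =>
      induction y using BaseChange.induction with
      | zero => simp only [BaseChange.lie_zero', BaseChange.zero_lie_base, BaseChange.lie_base_zero,
          add_zero]
      | add x x' hx hx' =>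
        simp only [BaseChange.lie_add', BaseChange.add_lie_base, BaseChange.lie_base_add, hx, hx']
        abel
      | tmul t Y =>
        have hsub (x y : BaseChange A h R) (s : R) : ⁅x - y, s⁆ = ⁅x, s⁆ - ⁅y, s⁆ :=
          DFunLike.congr_fun (map_sub (anchorHom A h R) x y) s
        simp only [lie_tmul_tmul, BaseChange.add_lie_base, hsub, tmul_lie,
          IsDerivationAction.lie_mul (A := A) (h := h) (R := R), lie_lie]
        ring

variable [LieModule k h R]

instance : LieAlgebra k (BaseChange A h R) where
  lie_smul c x y := by
    induction x using BaseChange.induction with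
    | zero => simp only [zero_lie, smul_zero]
    | add x x' hx hx' => simp only [add_lie, smul_add, hx, hx']
    | tmul r X =>
      induction y using BaseChange.induction with
      | zero => simp only [lie_zero, smul_zero]
      | add x x' hx hx' => simp only [lie_add, smul_add, hx, hx']
      | tmul s Y =>
        have hs : ⁅X, c • s⁆ = c • ⁅X, s⁆ := lie_smul c X s
        simp only [smul_tmul', lie_tmul_tmul, smul_add, smul_sub, hs, mul_smul_comm,
          smul_mul_assoc]

end BaseChange

end BaseChange

end LieRinehartAlgebra

end

open LeftBialgebroid LieRinehartAlgebra

/-!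
The enveloping algebra `U = U_A(h)` is generated by `1` as a left module over itself under `A` and
`h` (`Enveloping.induction_left`), and all its structure maps are defined by letting `h` act
diagonally: `comul (X * u) = diagLie X (comul u)` and `counit (X * u) = ⁅X, counit u⁆`.  Each
bialgebroid axiom states that two maps on `U` agree; they agree at `1`, are `A`-linear, and
intertwine left multiplication by `X` with the same diagonal operator.  The module algebra axioms
for `R` are proved in the same way.

The inverse of the Hopf-Galois map is `u ⊗ v ↦ u₊ ⊗ u₋ * v`, where the translation map is determined
by `a₊ ⊗ a₋ = a ⊗ 1`, `X₊ ⊗ X₋ = X ⊗ 1 - 1 ⊗ X` and `(X * u)₊ ⊗ (X * u)₋ = X * u₊ ⊗ u₋ - u₊ ⊗ u₋ * X`.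
The operators `x ⊗ y ↦ X * x ⊗ y - x ⊗ y * X` and `x ⊗ y ↦ a * x ⊗ y` satisfy the defining relations
of `U` on the subspace `BalancedTensor.center` of those tensors on which `a * x ⊗ y = x ⊗ y * a`, and
`1 ⊗ 1` lies in this subspace; the translation map is the orbit map of `1 ⊗ 1`
(`Enveloping.centerAction`, `Enveloping.trans`).  The Hopf-Galois map is thus inverted without the
Poincaré-Birkhoff-Witt theorem.

For the isomorphism, the universal property gives `U_R(R ⋊ h) → R # U` (`Enveloping.toSmash`) and
`U → U_R(R ⋊ h)` (`Enveloping.toBaseChange`); the latter extends `R`-linearly to `R # U`.  Both maps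
intertwine left multiplication by `R ⋊ h`, so they are mutually inverse.  As left multiplication by
`r # X` acts on the coproduct and the counit of `R # U` by the diagonal operator and the anchor,
`toSmash` is also a morphism of coalgebras.  Thus the Hopf algebroid structure of `R # U` is
transported from the one of `U_R(R ⋊ h)`, which is the first part of the argument applied to `R ⋊ h`.
-/

open scoped TensorProduct

noncomputable section

/-! ### Derivations along a tensor product -/

section TensorDerivation

variable {A M N : Type*} [CommRing A] [AddCommGroup M] [Module A M] [AddCommGroup N] [Module A N]

/-- The operator `D ⊗ 1 + 1 ⊗ D'` on `M ⊗[A] N`.  The operators `D` and `D'` need not be `A`-linear;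
it suffices that both satisfy the Leibniz rule with respect to the same map `δ : A → A`. -/
def tensorDerivation (δ : A → A) (D : M →+ M) (D' : N →+ N)
    (hD : ∀ a m, D (a • m) = a • D m + δ a • m) (hD' : ∀ a n, D' (a • n) = a • D' n + δ a • n) :
    M ⊗[A] N →+ M ⊗[A] N :=
  TensorProduct.liftAddHom
    { toFun := fun m =>
        { toFun := fun n => D m ⊗ₜ n + m ⊗ₜ D' n
          map_zero' := by simp
          map_add' := fun n n' => by simp only [map_add, TensorProduct.tmul_add]; abel }
      map_zero' := by ext n; simp
      map_add' := fun m m' => by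
        ext n
        simp only [map_add, TensorProduct.add_tmul, AddMonoidHom.coe_mk, ZeroHom.coe_mk,
          AddMonoidHom.add_apply]
        abel }
    (fun a m n => by
      simp only [AddMonoidHom.coe_mk, ZeroHom.coe_mk, hD, hD', TensorProduct.add_tmul,
        TensorProduct.tmul_add, TensorProduct.smul_tmul]
      abel)

end TensorDerivation

/-! ### The enveloping algebra is a cocommutative left bialgebroid -/

namespace LieRinehartAlgebra

namespace Enveloping

open CoalgebraStruct

section Basic

variable {k A h : Type*} [CommRing k] [CommRing A] [Algebra k A] [LieRing h] [LieAlgebra k h]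
  [Module A h] [LieRingModule h A]

/-- Induction on the enveloping algebra as a left module over itself: it is generated by `1` under
left multiplication by `A` and by `h`. -/
@[elab_as_elim]
lemma induction_left {p : Enveloping k A h → Prop} (u : Enveloping k A h) (one : p 1)
    (add : ∀ u v, p u → p v → p (u + v)) (smul : ∀ (a : A) u, p u → p (a • u))
    (lie_mul : ∀ (X : h) u, p u → p (ιL k A h X * u)) : p u := by
  have key (t : TensorAlgebra k (A × h)) : ∀ v, p v → p (mk k A h t * v) := by
    induction t using TensorAlgebra.induction with
    | algebraMap c =>
      intro v hv
      have hc : mk k A h (algebraMap k _ c) * v = algebraMap k A c • v := by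
        rw [AlgHom.commutes, smul_def, AlgHom.commutes]
      exact hc ▸ smul _ v hv
    | ι x =>
      intro v hv
      have hx : mk k A h (TensorAlgebra.ι k x) = ιA k A h x.1 + ιL k A h x.2 := by
        change _ = mk k A h (TensorAlgebra.ι k (x.1, 0)) + mk k A h (TensorAlgebra.ι k (0, x.2))
        rw [← map_add, ← map_add, Prod.mk_add_mk, add_zero, zero_add]
      rw [hx, add_mul]
      exact add _ _ (smul _ v hv) (lie_mul _ v hv)
    | mul x y hx hy => intro v hv; rw [map_mul, mul_assoc]; exact hx _ (hy v hv)
    | add x y hx hy => intro v hv; rw [map_add, add_mul]; exact add _ _ (hx v hv) (hy v hv)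
  obtain ⟨t, rfl⟩ := RingQuot.mkAlgHom_surjective k (EnvelopingRel k A h) u
  have := key t 1 one
  rwa [mul_one] at this

lemma ιL_mul_smul (X : h) (a : A) (u : Enveloping k A h) :
    ιL k A h X * (a • u) = a • (ιL k A h X * u) + ⁅X, a⁆ • u := by
  rw [smul_def, smul_def, smul_def, ← ιL_mul_ιA, sub_mul, mul_assoc, mul_assoc]
  abel

lemma source_eq (a : A) : source k A (Enveloping k A h) a = ιA k A h a := mul_one _

lemma diagLie_smul (X : h) (a : A) (t : Enveloping k A h ⊗[A] Enveloping k A h) :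
    diagLie k A h X (a • t) = a • diagLie k A h X t + ⁅X, a⁆ • t := by
  induction t with
  | zero => simp
  | add x y hx hy => simp only [smul_add, map_add, hx, hy]; abel
  | tmul u v =>
    simp only [TensorProduct.smul_tmul', diagLie_tmul, ιL_mul_smul, TensorProduct.add_tmul,
      smul_add]
    abel

variable (k A h) in
/-- The operator `X ⊗ 1 ⊗ 1 + 1 ⊗ X ⊗ 1 + 1 ⊗ 1 ⊗ X` on `U ⊗ (U ⊗ U)` for `U = U_A(h)`. -/
def diagLie₃ (X : h) :
    Enveloping k A h ⊗[A] (Enveloping k A h ⊗[A] Enveloping k A h) →+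
      Enveloping k A h ⊗[A] (Enveloping k A h ⊗[A] Enveloping k A h) :=
  tensorDerivation (fun a : A => ⁅X, a⁆) (AddMonoidHom.mulLeft (ιL k A h X))
    (diagLie k A h X).toAddMonoidHom (ιL_mul_smul X) (diagLie_smul X)

@[simp] lemma diagLie₃_tmul (X : h) (u : Enveloping k A h)
    (t : Enveloping k A h ⊗[A] Enveloping k A h) :
    diagLie₃ k A h X (u ⊗ₜ t) = (ιL k A h X * u) ⊗ₜ t + u ⊗ₜ diagLie k A h X t := rfl

lemma comm_diagLie (X : h) (t : Enveloping k A h ⊗[A] Enveloping k A h) :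
    TensorProduct.comm A _ _ (diagLie k A h X t) =
      diagLie k A h X (TensorProduct.comm A _ _ t) := by
  induction t with
  | zero => simp
  | add x y hx hy => simp only [map_add, hx, hy]
  | tmul u v => simp [add_comm]

lemma factorwiseMul_diagLie (w : Enveloping k A h ⊗[k] Enveloping k A h) (X : h)
    (t : Enveloping k A h ⊗[A] Enveloping k A h) :
    factorwiseMul k A _ w (diagLie k A h X t) =
      diagLie k A h X (factorwiseMul k A _ w t) := by
  induction w with
  | zero => simp
  | add x y hx hy => simp only [map_add, LinearMap.add_apply, hx, hy]
  | tmul v v' =>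
    induction t with
    | zero => simp
    | add x y hx hy => simp only [map_add, hx, hy]
    | tmul u u' => simp [mul_assoc]

end Basic

section Coalgebra

variable {k A h : Type*} [CommRing k] [CommRing A] [Algebra k A] [LieRing h] [LieAlgebra k h]
  [Module A h] [LieRingModule h A] [LieRinehartRing A h] [LieRinehartAlgebra k A h]

lemma comul_one : comul (R := A) (1 : Enveloping k A h) = 1 ⊗ₜ[A] 1 := by
  change diag k A h 1 (1 ⊗ₜ[A] 1) = _
  rw [map_one, Module.End.one_apply]

lemma comul_ιL_mul (X : h) (u : Enveloping k A h) :
    comul (R := A) (ιL k A h X * u) = diagLie k A h X (comul (R := A) u) := by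
  change diag k A h _ (1 ⊗ₜ[A] 1) = diagLie k A h X (diag k A h u (1 ⊗ₜ[A] 1))
  rw [map_mul, Module.End.mul_apply]
  congr 1
  exact lift_ιL _ _ _ _ _ X

lemma counit_apply (u : Enveloping k A h) : counit (R := A) u = u • (1 : A) := rfl

lemma counit_ιL_mul (X : h) (u : Enveloping k A h) :
    counit (R := A) (ιL k A h X * u) = ⁅X, counit (R := A) u⁆ := by
  rw [counit_apply, mul_smul, ιL_smul_eq, counit_apply]

lemma assoc_rTensor_comul_diagLie (X : h) (t : Enveloping k A h ⊗[A] Enveloping k A h) :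
    TensorProduct.assoc A _ _ _ (comul.rTensor (Enveloping k A h) (diagLie k A h X t)) =
      diagLie₃ k A h X (TensorProduct.assoc A _ _ _ (comul.rTensor (Enveloping k A h) t)) := by
  induction t with
  | zero => simp
  | add x y hx hy => simp only [map_add, hx, hy]
  | tmul u v =>
    rw [diagLie_tmul, map_add, LinearMap.rTensor_tmul, LinearMap.rTensor_tmul,
      LinearMap.rTensor_tmul, comul_ιL_mul]
    generalize comul (R := A) u = s
    induction s with
    | zero => simp
    | add x y hx hy =>
      simp only [map_add, TensorProduct.add_tmul] at hx hy ⊢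
      rw [← hx, ← hy]; abel
    | tmul x y => simp [TensorProduct.add_tmul, TensorProduct.tmul_add, add_assoc]

lemma lTensor_comul_diagLie (X : h) (t : Enveloping k A h ⊗[A] Enveloping k A h) :
    comul.lTensor (Enveloping k A h) (diagLie k A h X t) =
      diagLie₃ k A h X (comul.lTensor (Enveloping k A h) t) := by
  induction t with
  | zero => simp
  | add x y hx hy => simp only [map_add, hx, hy]
  | tmul u v => simp [comul_ιL_mul]

lemma comul_coassoc (u : Enveloping k A h) :
    TensorProduct.assoc A _ _ _ (comul.rTensor (Enveloping k A h) (comul (R := A) u)) =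
      comul.lTensor (Enveloping k A h) (comul (R := A) u) := by
  induction u using induction_left with
  | one => simp [comul_one]
  | add u v hu hv => simp only [map_add, hu, hv]
  | smul a u hu => simp only [map_smul, hu]
  | lie_mul X u hu => rw [comul_ιL_mul, assoc_rTensor_comul_diagLie, hu, lTensor_comul_diagLie]

lemma comm_comul (u : Enveloping k A h) :
    TensorProduct.comm A _ _ (comul (R := A) u) = comul (R := A) u := by
  induction u using induction_left with
  | one => simp [comul_one]
  | add u v hu hv => simp only [map_add, hu, hv]
  | smul a u hu => simp only [map_smul, hu]
  | lie_mul X u hu => rw [comul_ιL_mul, comm_diagLie, hu]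

lemma rTensor_counit_comul (u : Enveloping k A h) :
    counit.rTensor (Enveloping k A h) (comul (R := A) u) = (1 : A) ⊗ₜ[A] u := by
  have key (X : h) (t : Enveloping k A h ⊗[A] Enveloping k A h) :
      TensorProduct.lid A _ (counit.rTensor (Enveloping k A h) (diagLie k A h X t)) =
        ιL k A h X * TensorProduct.lid A _ (counit.rTensor (Enveloping k A h) t) := by
    induction t with
    | zero => simp
    | add x y hx hy => simp only [map_add, hx, hy, mul_add]
    | tmul u v => simp [counit_ιL_mul, ιL_mul_smul, add_comm]
  apply (TensorProduct.lid A (Enveloping k A h)).injective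
  rw [TensorProduct.lid_tmul, one_smul]
  induction u using induction_left with
  | one => simp [comul_one, counit_apply]
  | add u v hu hv => simp only [map_add, hu, hv]
  | smul a u hu => simp only [map_smul, hu]
  | lie_mul X u hu => rw [comul_ιL_mul, key, hu]

lemma lTensor_counit_comul (u : Enveloping k A h) :
    counit.lTensor (Enveloping k A h) (comul (R := A) u) = u ⊗ₜ[A] (1 : A) := by
  apply (TensorProduct.comm A _ _).injective
  rw [TensorProduct.comm_tmul, ← rTensor_counit_comul u]
  conv_rhs => rw [← comm_comul u]
  generalize comul (R := A) u = t
  induction t with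
  | zero => simp
  | add x y hx hy => simp only [map_add, hx, hy]
  | tmul u v => simp

lemma comul_takeuchi (u : Enveloping k A h) (a : A) :
    (LinearMap.mulRight A (ιA k A h a)).rTensor (Enveloping k A h) (comul (R := A) u) =
      (LinearMap.mulRight A (ιA k A h a)).lTensor (Enveloping k A h) (comul (R := A) u) := by
  have hr (X : h) (t : Enveloping k A h ⊗[A] Enveloping k A h) :
      (LinearMap.mulRight A (ιA k A h a)).rTensor (Enveloping k A h) (diagLie k A h X t) =
        diagLie k A h X ((LinearMap.mulRight A (ιA k A h a)).rTensor (Enveloping k A h) t) := by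
    induction t with
    | zero => simp
    | add x y hx hy => simp only [map_add, hx, hy]
    | tmul u v => simp [mul_assoc]
  have hl (X : h) (t : Enveloping k A h ⊗[A] Enveloping k A h) :
      (LinearMap.mulRight A (ιA k A h a)).lTensor (Enveloping k A h) (diagLie k A h X t) =
        diagLie k A h X ((LinearMap.mulRight A (ιA k A h a)).lTensor (Enveloping k A h) t) := by
    induction t with
    | zero => simp
    | add x y hx hy => simp only [map_add, hx, hy]
    | tmul u v => simp [mul_assoc]
  induction u using induction_left with
  | one =>
    have h1 : ιA k A h a = a • 1 := (mul_one _).symm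
    rw [comul_one, LinearMap.rTensor_tmul, LinearMap.lTensor_tmul, LinearMap.mulRight_apply, one_mul,
      h1, TensorProduct.smul_tmul]
  | add u v hu hv => simp only [map_add, hu, hv]
  | smul a u hu => simp only [map_smul, hu]
  | lie_mul X u hu => rw [comul_ιL_mul, hr, hl, hu]

lemma comul_mul (u v : Enveloping k A h) (w : Enveloping k A h ⊗[k] Enveloping k A h)
    (hw : proj k A _ w = comul (R := A) v) :
    comul (R := A) (u * v) = factorwiseMul k A _ w (comul (R := A) u) := by
  induction u using induction_left with
  | one =>
    rw [one_mul, comul_one, ← hw]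
    clear hw
    induction w with
    | zero => simp
    | add x y hx hy => simp only [map_add, LinearMap.add_apply, hx, hy]
    | tmul x y => simp
  | add u u' hu hu' => simp only [add_mul, map_add, hu, hu']
  | smul a u hu => simp only [smul_mul_assoc, map_smul, hu]
  | lie_mul X u hu => rw [mul_assoc, comul_ιL_mul, comul_ιL_mul, factorwiseMul_diagLie, hu]

variable (k A h) in
lemma isCocommLeftBialgebroid : IsCocommLeftBialgebroid k A (Enveloping k A h) where
  coassoc := LinearMap.ext comul_coassoc
  rTensor_counit_comp_comul := LinearMap.ext rTensor_counit_comul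
  lTensor_counit_comp_comul := LinearMap.ext lTensor_counit_comul
  comul_comm := LinearMap.ext comm_comul
  counit_one := one_smul _ 1
  counit_mul u v := by
    rw [source_eq, counit_apply, counit_apply, mul_smul, mul_smul, ιA_smul, counit_apply,
      smul_eq_mul, mul_one]
  comul_takeuchi u a := by rw [source_eq]; exact comul_takeuchi u a
  comul_one := comul_one
  comul_mul := comul_mul

end Coalgebra

end Enveloping

end LieRinehartAlgebra

/-! ### Transport of Hopf algebroid structures -/

namespace LeftBialgebroid

open CoalgebraStruct

section Transport

variable {k A U V : Type*} [CommRing k] [CommRing A] [Algebra k A]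
  [Ring U] [Algebra k U] [Module A U] [IsScalarTower k A U]
  [Ring V] [Algebra k V] [Module A V] [IsScalarTower k A V]

variable (k) in
/-- The `k`-linear map underlying an `A`-linear equivalence. -/
def scalarMap (e : U ≃ₗ[A] V) : U →ₗ[k] V := e.toLinearMap.restrictScalars k

@[simp] lemma scalarMap_apply (e : U ≃ₗ[A] V) (u : U) : scalarMap k e u = e u := rfl

variable (e : U ≃ₗ[A] V)

lemma equiv_map_one (hmul : ∀ u v, e (u * v) = e u * e v) : e 1 = 1 := by
  have h1 := hmul 1 (e.symm 1)
  rw [one_mul, e.apply_symm_apply, mul_one] at h1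
  exact h1.symm

lemma map_scalarMap_surjective :
    Function.Surjective (TensorProduct.map (scalarMap k e) (scalarMap k e)) :=
  have he : Function.Surjective (scalarMap k e) := e.surjective
  TensorProduct.map_surjective he he

lemma proj_map (w : U ⊗[k] U) :
    proj k A V (TensorProduct.map (scalarMap k e) (scalarMap k e) w) =
      TensorProduct.congr e e (proj k A U w) := by
  induction w with
  | zero => simp
  | add x y hx hy => simp only [map_add, hx, hy]
  | tmul x y => rfl

variable [IsScalarTower A U U] [IsScalarTower A V V]

section Mul

variable (hmul : ∀ u v, e (u * v) = e u * e v)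

include hmul

lemma equiv_source (a : A) : e (source k A U a) = source k A V a := by
  change e (a • 1) = a • 1
  rw [map_smul, equiv_map_one e hmul]

lemma factorwiseMul_map (w : U ⊗[k] U) (t : U ⊗[A] U) :
    factorwiseMul k A V (TensorProduct.map (scalarMap k e) (scalarMap k e) w)
        (TensorProduct.congr e e t) =
      TensorProduct.congr e e (factorwiseMul k A U w t) := by
  induction w with
  | zero => simp
  | add x y hx hy => simp only [map_add, LinearMap.add_apply, hx, hy]
  | tmul v v' =>
    induction t with
    | zero => simp
    | add x y hx hy => simp only [map_add, hx, hy]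
    | tmul x y => simp [hmul]

lemma rTensor_mulRight_congr (v : U) (t : U ⊗[A] U) :
    (LinearMap.mulRight A (e v)).rTensor V (TensorProduct.congr e e t) =
      TensorProduct.congr e e ((LinearMap.mulRight A v).rTensor U t) := by
  induction t with
  | zero => simp
  | add x y hx hy => simp only [map_add, hx, hy]
  | tmul x y => simp [hmul]

lemma lTensor_mulRight_congr (v : U) (t : U ⊗[A] U) :
    (LinearMap.mulRight A (e v)).lTensor V (TensorProduct.congr e e t) =
      TensorProduct.congr e e ((LinearMap.mulRight A v).lTensor U t) := by
  induction t with
  | zero => simp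
  | add x y hx hy => simp only [map_add, hx, hy]
  | tmul x y => simp [hmul]

/-- The map of balanced tensor products induced by a multiplicative `A`-linear equivalence. -/
def balancedMap : BalancedTensor k A U →ₗ[k] BalancedTensor k A V :=
  (balancedRel k A U).mapQ (balancedRel k A V)
    (TensorProduct.map (scalarMap k e) (scalarMap k e)) <| by
      rw [balancedRel, Submodule.span_le]
      rintro _ ⟨u, v, a, rfl⟩
      exact Submodule.subset_span ⟨e u, e v, a, by simp [hmul, equiv_source e hmul]⟩

lemma balancedMap_mkQ (w : U ⊗[k] U) :
    balancedMap e hmul ((balancedRel k A U).mkQ w) =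
      (balancedRel k A V).mkQ (TensorProduct.map (scalarMap k e) (scalarMap k e) w) := rfl

lemma balancedMap_surjective : Function.Surjective (balancedMap (k := k) e hmul) := fun t => by
  obtain ⟨t, rfl⟩ := Submodule.mkQ_surjective _ t
  obtain ⟨w, rfl⟩ := map_scalarMap_surjective e t
  exact ⟨(balancedRel k A U).mkQ w, rfl⟩

end Mul

variable [CoalgebraStruct A U] [CoalgebraStruct A V]
  (hmul : ∀ u v, e (u * v) = e u * e v)
  (hcomul : ∀ u, comul (R := A) (e u) = TensorProduct.congr e e (comul (R := A) u))
  (hcounit : ∀ u, counit (R := A) (e u) = counit (R := A) u)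

include hmul hcomul hcounit

/-- A cocommutative left bialgebroid structure can be transported along a bijection which is
multiplicative, `A`-linear, counital and comultiplicative. -/
lemma IsCocommLeftBialgebroid.of_equiv [IsCocommLeftBialgebroid k A U] :
    IsCocommLeftBialgebroid k A V where
  coassoc := by
    ext v
    obtain ⟨u, rfl⟩ := e.surjective v
    have h := LinearMap.congr_fun (IsCocommLeftBialgebroid.coassoc (k := k) (A := A) (U := U)) u
    have hr (t : U ⊗[A] U) : TensorProduct.assoc A V V V
        (comul.rTensor V (TensorProduct.congr e e t)) =
        TensorProduct.congr e (TensorProduct.congr e e)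
          (TensorProduct.assoc A U U U (comul.rTensor U t)) := by
      induction t with
      | zero => simp
      | add x y hx hy => simp only [map_add, hx, hy]
      | tmul x y =>
        rw [TensorProduct.congr_tmul, LinearMap.rTensor_tmul, LinearMap.rTensor_tmul, hcomul]
        generalize comul (R := A) x = s
        induction s with
        | zero => simp
        | add x y hx hy => simp only [map_add, TensorProduct.add_tmul, hx, hy]
        | tmul x z => simp
    have hl (t : U ⊗[A] U) : comul.lTensor V (TensorProduct.congr e e t) =
        TensorProduct.congr e (TensorProduct.congr e e) (comul.lTensor U t) := by
      induction t with
      | zero => simp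
      | add x y hx hy => simp only [map_add, hx, hy]
      | tmul x y => simp [hcomul]
    simp only [LinearMap.comp_apply, LinearEquiv.coe_coe] at h ⊢
    rw [hcomul, hr, hl, h]
  rTensor_counit_comp_comul := by
    ext v
    obtain ⟨u, rfl⟩ := e.surjective v
    have h := LinearMap.congr_fun
      (IsCocommLeftBialgebroid.rTensor_counit_comp_comul (k := k) (A := A) (U := U)) u
    have hr (t : U ⊗[A] U) : counit.rTensor V (TensorProduct.congr e e t) =
        e.toLinearMap.lTensor A (counit.rTensor U t) := by
      induction t with
      | zero => simp
      | add x y hx hy => simp only [map_add, hx, hy]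
      | tmul x y => simp [hcounit]
    simp only [LinearMap.comp_apply] at h ⊢
    rw [hcomul, hr, h]
    simp
  lTensor_counit_comp_comul := by
    ext v
    obtain ⟨u, rfl⟩ := e.surjective v
    have h := LinearMap.congr_fun
      (IsCocommLeftBialgebroid.lTensor_counit_comp_comul (k := k) (A := A) (U := U)) u
    have hl (t : U ⊗[A] U) : counit.lTensor V (TensorProduct.congr e e t) =
        e.toLinearMap.rTensor A (counit.lTensor U t) := by
      induction t with
      | zero => simp
      | add x y hx hy => simp only [map_add, hx, hy]
      | tmul x y => simp [hcounit]
    simp only [LinearMap.comp_apply] at h ⊢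
    rw [hcomul, hl, h]
    simp
  comul_comm := by
    ext v
    obtain ⟨u, rfl⟩ := e.surjective v
    have h := LinearMap.congr_fun
      (IsCocommLeftBialgebroid.comul_comm (k := k) (A := A) (U := U)) u
    have hc (t : U ⊗[A] U) : TensorProduct.comm A V V (TensorProduct.congr e e t) =
        TensorProduct.congr e e (TensorProduct.comm A U U t) := by
      induction t with
      | zero => simp
      | add x y hx hy => simp only [map_add, hx, hy]
      | tmul x y => simp
    simp only [LinearMap.comp_apply, LinearEquiv.coe_coe] at h ⊢
    rw [hcomul, hc, h]
  counit_one := by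
    rw [← equiv_map_one e hmul, hcounit, IsCocommLeftBialgebroid.counit_one k]
  counit_mul u v := by
    obtain ⟨u, rfl⟩ := e.surjective u
    obtain ⟨v, rfl⟩ := e.surjective v
    rw [← hmul, hcounit, hcounit, IsCocommLeftBialgebroid.counit_mul (k := k),
      ← equiv_source e hmul, ← hmul, hcounit]
  comul_takeuchi u a := by
    obtain ⟨u, rfl⟩ := e.surjective u
    rw [hcomul, ← equiv_source e hmul, rTensor_mulRight_congr e hmul,
      lTensor_mulRight_congr e hmul, IsCocommLeftBialgebroid.comul_takeuchi]
  comul_one := by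
    rw [← equiv_map_one e hmul, hcomul, IsCocommLeftBialgebroid.comul_one k,
      TensorProduct.congr_tmul]
  comul_mul u v w hw := by
    obtain ⟨u, rfl⟩ := e.surjective u
    obtain ⟨v, rfl⟩ := e.surjective v
    obtain ⟨w, rfl⟩ := map_scalarMap_surjective e w
    rw [proj_map, hcomul] at hw
    rw [← hmul, hcomul, hcomul, factorwiseMul_map e hmul,
      IsCocommLeftBialgebroid.comul_mul u v w ((TensorProduct.congr e e).injective hw)]

omit hcounit in
lemma galoisMap_balancedMap [IsCocommLeftBialgebroid k A U] [IsCocommLeftBialgebroid k A V]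
    (t : BalancedTensor k A U) :
    galoisMap k A V (balancedMap e hmul t) = TensorProduct.congr e e (galoisMap k A U t) := by
  obtain ⟨t, rfl⟩ := Submodule.mkQ_surjective _ t
  induction t with
  | zero => simp
  | add x y hx hy => simp only [map_add, hx, hy]
  | tmul x y =>
    change (LinearMap.mulRight A (e y)).lTensor V (comul (R := A) (e x)) =
      TensorProduct.congr e e ((LinearMap.mulRight A y).lTensor U (comul (R := A) x))
    rw [hcomul, lTensor_mulRight_congr e hmul]

/-- The Hopf-Galois maps of isomorphic bialgebroids are bijective simultaneously. -/
lemma IsCocommLeftHopfAlgebroid.of_equiv [IsCocommLeftHopfAlgebroid k A U] :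
    IsCocommLeftHopfAlgebroid k A V :=
  have : IsCocommLeftBialgebroid k A V := .of_equiv e hmul hcomul hcounit
  { galoisMap_bijective := by
      have hU := IsCocommLeftHopfAlgebroid.galoisMap_bijective (k := k) (A := A) (U := U)
      have hV := galoisMap_balancedMap (k := k) e hmul hcomul
      constructor
      · rw [injective_iff_map_eq_zero]
        intro t ht
        obtain ⟨t, rfl⟩ := balancedMap_surjective e hmul t
        rw [hV, LinearEquiv.map_eq_zero_iff] at ht
        rw [hU.1 (ht.trans (map_zero _).symm), map_zero]
      · intro t
        obtain ⟨s, hs⟩ := hU.2 ((TensorProduct.congr e e).symm t)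
        exact ⟨balancedMap e hmul s, by rw [hV, hs, LinearEquiv.apply_symm_apply]⟩ }

variable (k) in
/-- A bijection which is multiplicative, `A`-linear, counital and comultiplicative is an isomorphism
of Hopf algebroids: it is compatible with the Hopf-Galois maps, hence with the translation maps. -/
def HopfAlgebroidEquiv.ofLinearEquiv [IsCocommLeftHopfAlgebroid k A U]
    [IsCocommLeftHopfAlgebroid k A V] : HopfAlgebroidEquiv k A U V where
  __ := e
  counit_comp := LinearMap.ext hcounit
  map_comp_comul := LinearMap.ext fun u => (hcomul u).symm
  map_mul' := hmul
  map_translation u w hw := by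
    change (balancedRel k A V).mkQ (TensorProduct.map (scalarMap k e) (scalarMap k e) w) =
      translation k A V (e u)
    have hu : galoisMap k A U (translation k A U u) = u ⊗ₜ 1 :=
      (LinearEquiv.ofBijective (galoisMap k A U)
        IsCocommLeftHopfAlgebroid.galoisMap_bijective).apply_symm_apply _
    have hv : galoisMap k A V (translation k A V (e u)) = e u ⊗ₜ 1 :=
      (LinearEquiv.ofBijective (galoisMap k A V)
        IsCocommLeftHopfAlgebroid.galoisMap_bijective).apply_symm_apply _
    apply (IsCocommLeftHopfAlgebroid.galoisMap_bijective (k := k) (A := A) (U := V)).1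
    rw [hv, ← balancedMap_mkQ e hmul, galoisMap_balancedMap e hmul hcomul, hw, hu,
      TensorProduct.congr_tmul, equiv_map_one e hmul]

end Transport

end LeftBialgebroid

/-! ### The balanced tensor product as a bimodule -/

namespace LeftBialgebroid

namespace BalancedTensor

variable {k A U : Type*} [CommRing k] [CommRing A] [Algebra k A] [Ring U] [Algebra k U]
  [Module A U] [IsScalarTower k A U] [IsScalarTower A U U]

variable (k A) in
/-- The class of `u ⊗ v` in the balanced tensor product. -/
def tmul (u v : U) : BalancedTensor k A U := (balancedRel k A U).mkQ (u ⊗ₜ v)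

lemma tmul_source_mul (u v : U) (a : A) :
    tmul k A u (source k A U a * v) = tmul k A (u * source k A U a) v :=
  ((Submodule.Quotient.eq (balancedRel k A U)).2 (Submodule.subset_span ⟨u, v, a, rfl⟩)).symm

lemma hom_ext {M : Type*} [AddCommGroup M] [Module k M] {f g : BalancedTensor k A U →ₗ[k] M}
    (hfg : ∀ u v, f (tmul k A u v) = g (tmul k A u v)) : f = g :=
  Submodule.linearMap_qext _ (TensorProduct.ext' hfg)

variable (k A) in
/-- Outer left multiplication `x ⊗ y ↦ u * x ⊗ y`. -/
def leftMul (u : U) : Module.End k (BalancedTensor k A U) :=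
  (balancedRel k A U).mapQ _ ((LinearMap.mulLeft k u).rTensor U) <| by
    rw [balancedRel, Submodule.span_le]
    rintro _ ⟨x, y, a, rfl⟩
    exact Submodule.subset_span ⟨u * x, y, a, by simp [mul_assoc]⟩

variable (k A) in
/-- Outer right multiplication `x ⊗ y ↦ x ⊗ y * v`. -/
def rightMul (v : U) : Module.End k (BalancedTensor k A U) :=
  (balancedRel k A U).mapQ _ ((LinearMap.mulRight k v).lTensor U) <| by
    rw [balancedRel, Submodule.span_le]
    rintro _ ⟨x, y, a, rfl⟩
    exact Submodule.subset_span ⟨x, y * v, a, by simp [mul_assoc]⟩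

@[simp] lemma leftMul_tmul (u x y : U) : leftMul k A u (tmul k A x y) = tmul k A (u * x) y := rfl

@[simp] lemma rightMul_tmul (v x y : U) : rightMul k A v (tmul k A x y) = tmul k A x (y * v) := rfl

lemma tmul_add (u v v' : U) : tmul k A u (v + v') = tmul k A u v + tmul k A u v' := by
  simp [tmul, TensorProduct.tmul_add]

lemma add_tmul (u u' v : U) : tmul k A (u + u') v = tmul k A u v + tmul k A u' v := by
  simp [tmul, TensorProduct.add_tmul]

lemma tmul_smul (c : k) (u v : U) : tmul k A u (c • v) = c • tmul k A u v := by
  simp [tmul]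

lemma smul_tmul (c : k) (u v : U) : tmul k A (c • u) v = c • tmul k A u v := by
  rw [tmul, ← TensorProduct.smul_tmul', map_smul, tmul]

lemma leftMul_one : leftMul k A (1 : U) = 1 := hom_ext fun x y => by simp

lemma leftMul_add (u u' : U) : leftMul k A (u + u') = leftMul k A u + leftMul k A u' :=
  hom_ext fun x y => by simp [add_mul, add_tmul]

lemma leftMul_smul (c : k) (u : U) : leftMul k A (c • u) = c • leftMul k A u :=
  hom_ext fun x y => by simp [smul_tmul]

lemma leftMul_mul (u u' : U) : leftMul k A (u * u') = leftMul k A u * leftMul k A u' :=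
  hom_ext fun x y => by simp [mul_assoc]

lemma rightMul_one : rightMul k A (1 : U) = 1 := hom_ext fun x y => by simp

lemma rightMul_add (v v' : U) : rightMul k A (v + v') = rightMul k A v + rightMul k A v' :=
  hom_ext fun x y => by simp [mul_add, tmul_add]

lemma rightMul_smul (c : k) (v : U) : rightMul k A (c • v) = c • rightMul k A v :=
  hom_ext fun x y => by simp [tmul_smul]

lemma rightMul_mul (v v' : U) : rightMul k A (v * v') = rightMul k A v' * rightMul k A v :=
  hom_ext fun x y => by simp [mul_assoc]

lemma rightMul_mul_leftMul (u v : U) :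
    rightMul k A v * leftMul k A u = leftMul k A u * rightMul k A v :=
  hom_ext fun x y => by simp

variable (k A U) in
/-- The elements of the balanced tensor product on which the outer left and right actions of `A`
agree.  The translation map of a left Hopf algebroid takes its values here. -/
def center : Submodule k (BalancedTensor k A U) :=
  ⨅ a : A, LinearMap.ker (leftMul k A (source k A U a) - rightMul k A (source k A U a))

lemma mem_center {t : BalancedTensor k A U} : t ∈ center k A U ↔
    ∀ a : A, leftMul k A (source k A U a) t = rightMul k A (source k A U a) t := by
  simp [center, sub_eq_zero]

lemma one_tmul_one_mem_center : tmul k A (1 : U) 1 ∈ center k A U :=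
  mem_center.2 fun a => by
    have := tmul_source_mul (k := k) (1 : U) 1 a
    rw [leftMul_tmul, rightMul_tmul, mul_one, one_mul]
    rw [mul_one, one_mul] at this
    exact this.symm

lemma leftMul_source_mem_center (a : A) {t : BalancedTensor k A U} (ht : t ∈ center k A U) :
    leftMul k A (source k A U a) t ∈ center k A U :=
  mem_center.2 fun b => by
    rw [← Module.End.mul_apply (rightMul _ _ _), rightMul_mul_leftMul, Module.End.mul_apply,
      ← mem_center.1 ht, ← Module.End.mul_apply, ← Module.End.mul_apply, ← leftMul_mul,
      ← leftMul_mul, ← map_mul, ← map_mul, mul_comm]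

end BalancedTensor

end LeftBialgebroid

/-! ### The Hopf-Galois map of the enveloping algebra is bijective -/

namespace LieRinehartAlgebra

namespace Enveloping

open CoalgebraStruct BalancedTensor

section Translation

variable {k A h : Type*} [CommRing k] [CommRing A] [Algebra k A] [LieRing h] [LieAlgebra k h]
  [Module A h] [LieRingModule h A]

lemma sub_mem_center (X : h) {t : BalancedTensor k A (Enveloping k A h)}
    (ht : t ∈ center k A (Enveloping k A h)) :
    (leftMul k A (ιL k A h X) - rightMul k A (ιL k A h X)) t ∈ center k A (Enveloping k A h) := by
  refine mem_center.2 fun a => ?_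
  have ha := mem_center.1 ht a
  have hXa := mem_center.1 ht ⁅X, a⁆
  simp only [source_eq] at ha hXa ⊢
  -- the commutator of the operator of `X` with `L a - R a` is `L ⁅X, a⁆ - R ⁅X, a⁆`, for the outer
  -- actions `L` and `R`; both differences vanish at `t`
  have hl : leftMul k A (ιA k A h a) * leftMul k A (ιL k A h X) =
      leftMul k A (ιL k A h X) * leftMul k A (ιA k A h a) - leftMul k A (ιA k A h ⁅X, a⁆) := by
    rw [eq_sub_iff_add_eq, ← leftMul_mul, ← leftMul_mul, ← leftMul_add, ← ιL_mul_ιA]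
    congr 1; abel
  have hr : rightMul k A (ιA k A h a) * rightMul k A (ιL k A h X) =
      rightMul k A (ιL k A h X) * rightMul k A (ιA k A h a) + rightMul k A (ιA k A h ⁅X, a⁆) := by
    rw [← rightMul_mul, ← rightMul_mul, ← rightMul_add, ← ιL_mul_ιA]
    congr 1; abel
  rw [LinearMap.sub_apply, map_sub, map_sub]
  simp only [← Module.End.mul_apply]
  rw [hl, hr, ← rightMul_mul_leftMul, rightMul_mul_leftMul (ιL k A h X)]
  simp only [Module.End.mul_apply, LinearMap.sub_apply, LinearMap.add_apply, ha, hXa]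
  abel

variable (k A h) in
/-- The action of the enveloping algebra on the central part of the balanced tensor product:
`a` acts by `x ⊗ y ↦ a * x ⊗ y` and `X` by `x ⊗ y ↦ X * x ⊗ y - x ⊗ y * X`.  The relation
`a • X = a * X` holds only on the central part. -/
def centerAction : Enveloping k A h →ₐ[k] Module.End k (center k A (Enveloping k A h)) :=
  lift
    (AlgHom.ofLinearMap
      { toFun := fun a => (leftMul k A (source k A _ a)).restrict
          fun _ => leftMul_source_mem_center a
        map_add' := fun a b => by ext t; simp [leftMul_add, LinearMap.restrict_apply]
        map_smul' := fun c a => by ext t; simp [leftMul_smul, LinearMap.restrict_apply] }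
      (by ext t; simp [leftMul_one, LinearMap.restrict_apply])
      (fun a b => by ext t; simp [leftMul_mul, LinearMap.restrict_apply]))
    { toFun := fun X => (leftMul k A (ιL k A h X) - rightMul k A (ιL k A h X)).restrict
        fun _ => sub_mem_center X
      map_add' := fun X Y => by
        ext t
        simp only [LinearMap.restrict_apply, map_add, leftMul_add, rightMul_add,
          LinearMap.add_apply, LinearMap.sub_apply, Submodule.coe_add]
        abel
      map_smul' := fun c X => by
        ext t
        simp [LinearMap.restrict_apply, leftMul_smul, rightMul_smul, smul_sub] }
    (fun X Y => by
      ext t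
      have h1 : leftMul k A (ιL k A h ⁅X, Y⁆) + leftMul k A (ιL k A h Y) * leftMul k A (ιL k A h X) =
          leftMul k A (ιL k A h X) * leftMul k A (ιL k A h Y) := by
        rw [← leftMul_mul, ← leftMul_mul, ← leftMul_add, ιL_lie, sub_add_cancel]
      have h2 : rightMul k A (ιL k A h ⁅X, Y⁆) +
          rightMul k A (ιL k A h X) * rightMul k A (ιL k A h Y) =
          rightMul k A (ιL k A h Y) * rightMul k A (ιL k A h X) := by
        rw [← rightMul_mul, ← rightMul_mul, ← rightMul_add, ιL_lie, sub_add_cancel]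
      have key : leftMul k A (ιL k A h ⁅X, Y⁆) - rightMul k A (ιL k A h ⁅X, Y⁆) =
          (leftMul k A (ιL k A h X) - rightMul k A (ιL k A h X)) *
            (leftMul k A (ιL k A h Y) - rightMul k A (ιL k A h Y)) -
          (leftMul k A (ιL k A h Y) - rightMul k A (ιL k A h Y)) *
            (leftMul k A (ιL k A h X) - rightMul k A (ιL k A h X)) := by
        rw [eq_sub_of_add_eq h1, eq_sub_of_add_eq h2]
        simp only [sub_mul, mul_sub, rightMul_mul_leftMul]
        abel
      exact LinearMap.congr_fun key t.1)
    (fun a X => by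
      ext t
      have ha := mem_center.1 t.2 a
      have h1 : leftMul k A (source k A _ a) * rightMul k A (ιL k A h X) =
          rightMul k A (ιL k A h X) * leftMul k A (source k A _ a) := (rightMul_mul_leftMul _ _).symm
      change leftMul k A (ιL k A h (a • X)) t.1 - rightMul k A (ιL k A h (a • X)) t.1 =
        leftMul k A (source k A _ a) (leftMul k A (ιL k A h X) t.1 - rightMul k A (ιL k A h X) t.1)
      rw [map_sub, ← Module.End.mul_apply, ← Module.End.mul_apply, h1, Module.End.mul_apply _ _ t.1,
        Module.End.mul_apply _ _ t.1, ha, ιL_smul, leftMul_mul, rightMul_mul, source_eq]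
      rfl)
    (fun X a => by
      ext t
      have h1 : leftMul k A (ιA k A h ⁅X, a⁆) =
          leftMul k A (ιL k A h X) * leftMul k A (ιA k A h a) -
            leftMul k A (ιA k A h a) * leftMul k A (ιL k A h X) := by
        rw [eq_sub_iff_add_eq, ← leftMul_mul, ← leftMul_mul, ← leftMul_add, ← ιL_mul_ιA,
          sub_add_cancel]
      have key : (leftMul k A (ιL k A h X) - rightMul k A (ιL k A h X)) *
            leftMul k A (source k A _ a) -
          leftMul k A (source k A _ a) * (leftMul k A (ιL k A h X) - rightMul k A (ιL k A h X)) =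
          leftMul k A (source k A (Enveloping k A h) ⁅X, a⁆) := by
        simp only [source_eq, h1, sub_mul, mul_sub, rightMul_mul_leftMul]
        abel
      exact LinearMap.congr_fun key t.1)

variable (k A h) in
/-- The translation map `u ↦ u₊ ⊗ u₋`, with `X₊ ⊗ X₋ = X ⊗ 1 - 1 ⊗ X` for `X` in `h`. -/
def trans : Enveloping k A h →ₗ[k] BalancedTensor k A (Enveloping k A h) :=
  (center k A (Enveloping k A h)).subtype ∘ₗ
    LinearMap.applyₗ ⟨tmul k A 1 1, one_tmul_one_mem_center⟩ ∘ₗ (centerAction k A h).toLinearMap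

lemma trans_one : trans k A h 1 = tmul k A 1 1 := by simp [trans]

lemma trans_smul (a : A) (u : Enveloping k A h) :
    trans k A h (a • u) = leftMul k A (ιA k A h a) (trans k A h u) := by
  simp only [trans, smul_def, LinearMap.comp_apply, AlgHom.toLinearMap_apply, map_mul]
  rw [centerAction, lift_ιA, ← source_eq]
  rfl

lemma leftMul_ιA_trans (a : A) (u : Enveloping k A h) :
    leftMul k A (ιA k A h a) (trans k A h u) = rightMul k A (ιA k A h a) (trans k A h u) := by
  have := mem_center.1 (Subtype.prop
    (centerAction k A h u ⟨tmul k A 1 1, one_tmul_one_mem_center⟩)) a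
  rwa [source_eq] at this

lemma trans_ιL_mul (X : h) (u : Enveloping k A h) :
    trans k A h (ιL k A h X * u) =
      leftMul k A (ιL k A h X) (trans k A h u) - rightMul k A (ιL k A h X) (trans k A h u) := by
  simp only [trans, LinearMap.comp_apply, AlgHom.toLinearMap_apply, map_mul]
  rw [centerAction, lift_ιL]
  rfl

variable (k A h) in
/-- The inverse `u ⊗ v ↦ u₊ ⊗ u₋ * v` of the Hopf-Galois map. -/
def galoisInv :
    Enveloping k A h ⊗[A] Enveloping k A h →+ BalancedTensor k A (Enveloping k A h) :=
  TensorProduct.liftAddHom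
    { toFun := fun u =>
        { toFun := fun v => rightMul k A v (trans k A h u)
          map_zero' := by
            rw [← zero_smul k (0 : Enveloping k A h), rightMul_smul, zero_smul,
              LinearMap.zero_apply]
          map_add' := fun v v' => by rw [rightMul_add, LinearMap.add_apply] }
      map_zero' := by ext v; simp
      map_add' := fun u u' => by ext v; simp }
    (fun a u v => by
      simp only [AddMonoidHom.coe_mk, ZeroHom.coe_mk]
      rw [trans_smul, leftMul_ιA_trans, smul_def, rightMul_mul, Module.End.mul_apply])

lemma galoisInv_tmul (u v : Enveloping k A h) :
    galoisInv k A h (u ⊗ₜ v) = rightMul k A v (trans k A h u) := rfl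

lemma galoisInv_smul (a : A) (t : Enveloping k A h ⊗[A] Enveloping k A h) :
    galoisInv k A h (a • t) = leftMul k A (ιA k A h a) (galoisInv k A h t) := by
  induction t with
  | zero => simp
  | add x y hx hy => simp only [smul_add, map_add, hx, hy]
  | tmul u v =>
    rw [TensorProduct.smul_tmul', galoisInv_tmul, trans_smul, ← Module.End.mul_apply,
      rightMul_mul_leftMul]
    rfl

lemma galoisInv_diagLie (X : h) (t : Enveloping k A h ⊗[A] Enveloping k A h) :
    galoisInv k A h (diagLie k A h X t) = leftMul k A (ιL k A h X) (galoisInv k A h t) := by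
  induction t with
  | zero => simp
  | add x y hx hy => simp only [map_add, hx, hy]
  | tmul u v =>
    rw [diagLie_tmul, map_add, galoisInv_tmul, galoisInv_tmul, galoisInv_tmul, trans_ιL_mul,
      rightMul_mul, Module.End.mul_apply, map_sub, sub_add_cancel, ← Module.End.mul_apply,
      rightMul_mul_leftMul, Module.End.mul_apply]

lemma galoisInv_lTensor_mulRight (v : Enveloping k A h)
    (t : Enveloping k A h ⊗[A] Enveloping k A h) :
    galoisInv k A h ((LinearMap.mulRight A v).lTensor _ t) =
      rightMul k A v (galoisInv k A h t) := by
  induction t with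
  | zero => simp
  | add x y hx hy => simp only [map_add, hx, hy]
  | tmul x y => simp [galoisInv_tmul, rightMul_mul]

lemma lTensor_mulRight_diagLie (v : Enveloping k A h) (X : h)
    (t : Enveloping k A h ⊗[A] Enveloping k A h) :
    (LinearMap.mulRight A v).lTensor _ (diagLie k A h X t) =
      diagLie k A h X ((LinearMap.mulRight A v).lTensor _ t) := by
  induction t with
  | zero => simp
  | add x y hx hy => simp only [map_add, hx, hy]
  | tmul x y => simp [mul_assoc]

end Translation

section Galois

variable {k A h : Type*} [CommRing k] [CommRing A] [Algebra k A] [LieRing h] [LieAlgebra k h]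
  [Module A h] [LieRingModule h A] [LieRinehartRing A h] [LieRinehartAlgebra k A h]

attribute [local instance] isCocommLeftBialgebroid

lemma galoisMap_tmul (u v : Enveloping k A h) : galoisMap k A _ (tmul k A u v) =
    (LinearMap.mulRight A v).lTensor _ (comul (R := A) u) := rfl

lemma galoisInv_comul (u : Enveloping k A h) :
    galoisInv k A h (comul (R := A) u) = tmul k A u 1 := by
  induction u using induction_left with
  | one => rw [comul_one, galoisInv_tmul, rightMul_one, trans_one]; rfl
  | add u v hu hv => rw [map_add, map_add, hu, hv, BalancedTensor.add_tmul]
  | smul a u hu => rw [map_smul, galoisInv_smul, hu, leftMul_tmul, smul_def]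
  | lie_mul X u hu => rw [comul_ιL_mul, galoisInv_diagLie, hu, leftMul_tmul]

lemma galoisInv_galoisMap (t : BalancedTensor k A (Enveloping k A h)) :
    galoisInv k A h (galoisMap k A _ t) = t := by
  obtain ⟨t, rfl⟩ := Submodule.mkQ_surjective _ t
  induction t with
  | zero => simp
  | add x y hx hy => simp only [map_add, hx, hy]
  | tmul u v =>
    change galoisInv k A h (galoisMap k A _ (tmul k A u v)) = tmul k A u v
    rw [galoisMap_tmul, galoisInv_lTensor_mulRight, galoisInv_comul, rightMul_tmul, one_mul]

lemma galoisMap_rightMul (v : Enveloping k A h) (t : BalancedTensor k A (Enveloping k A h)) :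
    galoisMap k A _ (rightMul k A v t) =
      (LinearMap.mulRight A v).lTensor _ (galoisMap k A _ t) := by
  refine LinearMap.congr_fun (f := galoisMap k A _ ∘ₗ rightMul k A v)
    (g := ((LinearMap.mulRight A v).lTensor _).restrictScalars k ∘ₗ galoisMap k A _)
    (BalancedTensor.hom_ext fun x y => ?_) t
  simp only [LinearMap.comp_apply, rightMul_tmul, galoisMap_tmul, LinearMap.coe_restrictScalars]
  generalize comul (R := A) x = s
  induction s with
  | zero => simp
  | add x y hx hy => simp only [map_add, hx, hy]
  | tmul x y => simp [mul_assoc]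

lemma galoisMap_leftMul_ιL (X : h) (t : BalancedTensor k A (Enveloping k A h)) :
    galoisMap k A _ (leftMul k A (ιL k A h X) t) = diagLie k A h X (galoisMap k A _ t) := by
  refine LinearMap.congr_fun (f := galoisMap k A _ ∘ₗ leftMul k A (ιL k A h X))
    (g := diagLie k A h X ∘ₗ galoisMap k A _) (BalancedTensor.hom_ext fun x y => ?_) t
  simp only [LinearMap.comp_apply, leftMul_tmul, galoisMap_tmul, comul_ιL_mul,
    lTensor_mulRight_diagLie]

lemma galoisMap_leftMul_ιA (a : A) (t : BalancedTensor k A (Enveloping k A h)) :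
    galoisMap k A _ (leftMul k A (ιA k A h a) t) = a • galoisMap k A _ t := by
  refine LinearMap.congr_fun (f := galoisMap k A _ ∘ₗ leftMul k A (ιA k A h a))
    (g := Algebra.lsmul k k _ a ∘ₗ galoisMap k A _) (BalancedTensor.hom_ext fun x y => ?_) t
  simp only [LinearMap.comp_apply, leftMul_tmul, galoisMap_tmul, ← smul_def, map_smul,
    Algebra.lsmul_coe]

lemma galoisMap_trans (u : Enveloping k A h) :
    galoisMap k A _ (trans k A h u) = u ⊗ₜ[A] 1 := by
  induction u using induction_left with
  | one => simp [trans_one, galoisMap_tmul, comul_one]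
  | add u v hu hv => rw [map_add, map_add, hu, hv, TensorProduct.add_tmul]
  | smul a u hu => rw [trans_smul, galoisMap_leftMul_ιA, hu, TensorProduct.smul_tmul']
  | lie_mul X u hu =>
    rw [trans_ιL_mul, map_sub, galoisMap_leftMul_ιL, galoisMap_rightMul, hu]
    simp

lemma galoisMap_galoisInv (t : Enveloping k A h ⊗[A] Enveloping k A h) :
    galoisMap k A _ (galoisInv k A h t) = t := by
  induction t with
  | zero => simp
  | add x y hx hy => simp only [map_add, hx, hy]
  | tmul u v => rw [galoisInv_tmul, galoisMap_rightMul, galoisMap_trans]; simp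

variable (k A h) in
lemma isCocommLeftHopfAlgebroid : IsCocommLeftHopfAlgebroid k A (Enveloping k A h) where
  __ := isCocommLeftBialgebroid k A h
  galoisMap_bijective := Function.bijective_iff_has_inverse.2
    ⟨galoisInv k A h, galoisInv_galoisMap, galoisMap_galoisInv⟩

end Galois

/-! ### Actions by derivations are module algebras -/

section ModuleAlgebra

variable {k A h R : Type*} [CommRing k] [CommRing A] [Algebra k A] [LieRing h] [LieAlgebra k h]
  [Module A h] [LieRingModule h A]
  [CommRing R] [Algebra k R] [Algebra A R] [IsScalarTower k A R] [LieRingModule h R]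
  [LieModule k h R] [IsDerivationAction A h R]

lemma mul'_map_orbitMap_diagLie (X : h) (r r' : R)
    (t : Enveloping k A h ⊗[A] Enveloping k A h) :
    LinearMap.mul' A R (TensorProduct.map (orbitMap A _ R r) (orbitMap A _ R r')
        (diagLie k A h X t)) =
      ⁅X, LinearMap.mul' A R (TensorProduct.map (orbitMap A _ R r) (orbitMap A _ R r') t)⁆ := by
  induction t with
  | zero => simp
  | add x y hx hy => simp only [map_add, lie_add, hx, hy]
  | tmul u v =>
    simp [orbitMap, mul_smul, ιL_smul_eq, IsDerivationAction.lie_mul (A := A) (h := h), add_comm]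

variable [LieRinehartRing A h] [LieRinehartAlgebra k A h]

variable (k A h R) in
lemma isModuleAlgebra : IsModuleAlgebra k A (Enveloping k A h) R where
  source_smul_mul a r r' := by
    rw [source_eq, ιA_smul, ιA_smul, smul_mul_assoc, mul_smul_comm]
  smul_mul u r r' := by
    induction u using induction_left with
    | one => simp [comul_one, orbitMap]
    | add u v hu hv => simp only [add_smul, map_add, hu, hv]
    | smul a u hu => simp only [smul_assoc, map_smul, hu]
    | lie_mul X u hu => rw [mul_smul, hu, comul_ιL_mul, mul'_map_orbitMap_diagLie, ιL_smul_eq]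
  smul_one u := by
    rw [source_eq, ιA_smul, ← Algebra.algebraMap_eq_smul_one]
    induction u using induction_left with
    | one => simp [counit_apply]
    | add u v hu hv => simp only [add_smul, map_add, hu, hv]
    | smul a u hu => rw [smul_assoc, hu, map_smul, Algebra.smul_def, smul_eq_mul, map_mul]
    | lie_mul X u hu =>
      rw [mul_smul, hu, counit_ιL_mul, ιL_smul_eq, IsDerivationAction.lie_algebraMap]

end ModuleAlgebra

end Enveloping

end LieRinehartAlgebra

/-! ### The Lie-Rinehart algebra `R ⋊ h` -/

namespace LieRinehartAlgebra

open CoalgebraStruct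

lemma lie_base_one {A h R : Type*} [CommRing A] [LieRing h] [Module A h] [LieRingModule h A]
    [CommRing R] [Algebra A R] [LieRingModule h R] [IsDerivationAction A h R] (X : h) :
    ⁅X, (1 : R)⁆ = 0 := by
  simpa using IsDerivationAction.lie_mul (A := A) X (1 : R) 1

section

variable {k A h R : Type*} [CommRing k] [CommRing A] [Algebra k A] [LieRing h] [LieAlgebra k h]
  [Module A h] [LieRingModule h A] [LieRinehartRing A h]
  [CommRing R] [Algebra k R] [Algebra A R] [IsScalarTower k A R] [LieRingModule h R]
  [LieModule k h R] [IsDerivationAction A h R]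

namespace BaseChange

variable (A h R) in
lemma lieRinehartRing : LieRinehartRing R (BaseChange A h R) where
  lie_smul_eq_mul' r s x := by
    induction x using BaseChange.induction with
    | zero => rw [smul_zero, zero_lie, mul_zero]
    | add x y hx hy => rw [smul_add, add_lie, add_lie, hx, hy, mul_add]
    | tmul t X => rw [smul_tmul, tmul_lie, tmul_lie, mul_assoc]
  leibniz_mul_right' x r s := by
    induction x using BaseChange.induction with
    | zero => simp only [zero_lie, smul_zero, zero_mul, add_zero]
    | add x y hx hy => simp only [add_lie, hx, hy, smul_eq_mul]; ring
    | tmul t X =>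
      simp only [tmul_lie, IsDerivationAction.lie_mul (A := A) (h := h) (R := R), smul_eq_mul]
      ring
  leibniz_smul_right' x y r := by
    induction x using BaseChange.induction with
    | zero => simp only [zero_lie, smul_zero, zero_smul, add_zero]
    | add x x' hx hx' => simp only [add_lie, hx, hx', smul_add, add_smul]; abel
    | tmul s X =>
      induction y using BaseChange.induction with
      | zero => simp only [lie_zero, smul_zero, add_zero]
      | add y y' hy hy' => simp only [lie_add, hy, hy', smul_add]; abel
      | tmul t Y =>
        simp only [smul_tmul, lie_tmul_tmul, tmul_lie, smul_add, smul_sub, mul_add, add_tmul,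
          IsDerivationAction.lie_mul (A := A) (h := h) (R := R)]
        ring_nf
        abel

attribute [local instance] lieRinehartRing

variable (k A h R) in
lemma lieRinehartAlgebra : LieRinehartAlgebra k R (BaseChange A h R) where
  smul_lie c x r := by
    induction x using BaseChange.induction with
    | zero => rw [smul_zero, zero_lie, smul_zero]
    | add x y hx hy => rw [smul_add, add_lie, add_lie, hx, hy, smul_add]
    | tmul t X => rw [smul_tmul', tmul_lie, tmul_lie, smul_mul_assoc]
  lie_smul c x r := by
    induction x using BaseChange.induction with
    | zero => rw [zero_lie, zero_lie, smul_zero]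
    | add x y hx hy => rw [add_lie, add_lie, hx, hy, smul_add]
    | tmul t X => rw [tmul_lie, tmul_lie, lie_smul, mul_smul_comm]

end BaseChange

/-! ### The isomorphism with the smash product -/

namespace Enveloping

variable (k A h) in
/-- The canonical map `h → U_A(h)` as an `A`-linear map. -/
def ιLinear : h →ₗ[A] Enveloping k A h where
  toFun := ιL k A h
  map_add' := map_add _
  map_smul' a X := ιL_smul a X

variable [LieRinehartAlgebra k A h]

attribute [local instance] isCocommLeftHopfAlgebroid isModuleAlgebra BaseChange.lieRinehartRing
  BaseChange.lieRinehartAlgebra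

lemma smash_smul_tmul (r s : R) (u : Enveloping k A h) :
    r • (Smash.tmul k s u : Smash k A (Enveloping k A h) R) = Smash.tmul k (r * s) u := rfl

lemma smash_add_tmul (r s : R) (u : Enveloping k A h) :
    (Smash.tmul k (r + s) u : Smash k A (Enveloping k A h) R) =
      Smash.tmul k r u + Smash.tmul k s u := TensorProduct.add_tmul r s u

lemma smash_tmul_add (r : R) (u v : Enveloping k A h) :
    (Smash.tmul k r (u + v) : Smash k A (Enveloping k A h) R) =
      Smash.tmul k r u + Smash.tmul k r v := TensorProduct.tmul_add r u v

lemma smash_tmul_sub (r : R) (u v : Enveloping k A h) :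
    (Smash.tmul k r (u - v) : Smash k A (Enveloping k A h) R) =
      Smash.tmul k r u - Smash.tmul k r v := TensorProduct.tmul_sub r u v

/-- Left multiplication by an element of `h` in the smash product. -/
lemma smash_tmul_ιL_mul (r s : R) (X : h) (u : Enveloping k A h) :
    (Smash.tmul k r (ιL k A h X) * Smash.tmul k s u : Smash k A (Enveloping k A h) R) =
      Smash.tmul k (r * ⁅X, s⁆) u + Smash.tmul k (r * s) (ιL k A h X * u) := by
  rw [Smash.tmul_mul_tmul, comul_ιL, map_add, Smash.mulAux_tmul, Smash.mulAux_tmul, one_smul,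
    one_mul, ιL_smul_eq, smul_add]
  rfl

variable (k A h R) in
/-- The map `r ⊗ X ↦ r # X` from `R ⋊ h` to the smash product. -/
def smashL : BaseChange A h R →ₗ[k] Smash k A (Enveloping k A h) R :=
  ((ιLinear k A h).baseChange R).restrictScalars k

@[simp] lemma smashL_tmul (r : R) (X : h) :
    smashL k A h R (BaseChange.tmul r X) = Smash.tmul k r (ιL k A h X) := rfl

lemma smashL_mul_smul (x : BaseChange A h R) (r : R) (y : Smash k A (Enveloping k A h) R) :
    smashL k A h R x * (r • y) = r • (smashL k A h R x * y) + ⁅x, r⁆ • y := by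
  induction x using BaseChange.induction with
  | zero => simp only [map_zero, zero_mul, smul_zero, zero_lie, zero_smul, add_zero]
  | add x x' hx hx' => simp only [map_add, add_mul, hx, hx', smul_add, add_lie, add_smul]; abel
  | tmul s X =>
    induction y using Smash.induction with
    | zero => simp only [smul_zero, mul_zero, add_zero]
    | add y y' hy hy' => simp only [smul_add, mul_add, hy, hy']; abel
    | tmul t u =>
      simp only [smash_smul_tmul, smashL_tmul, smash_tmul_ιL_mul, smul_add,
        IsDerivationAction.lie_mul (A := A) (h := h) (R := R), BaseChange.tmul_lie, mul_add,
        smash_add_tmul]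
      ring_nf
      abel

variable (k A h R) in
/-- The morphism of `k`-algebras `U_R(R ⋊ h) → R # U_A(h)`. -/
def toSmash : Enveloping k R (BaseChange A h R) →ₐ[k] Smash k A (Enveloping k A h) R :=
  lift (source k R _) (smashL k A h R)
    (fun x y => by
      induction x using BaseChange.induction with
      | zero => simp only [zero_lie, map_zero, zero_mul, mul_zero, sub_zero]
      | add x x' hx hx' => simp only [add_lie, map_add, add_mul, mul_add, hx, hx']; abel
      | tmul r X =>
        induction y using BaseChange.induction with
        | zero => simp only [lie_zero, map_zero, zero_mul, mul_zero, sub_zero]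
        | add y y' hy hy' => simp only [lie_add, map_add, add_mul, mul_add, hy, hy']; abel
        | tmul s Y =>
          simp only [BaseChange.lie_tmul_tmul, map_add, map_sub, smashL_tmul, smash_tmul_ιL_mul,
            ιL_lie, smash_tmul_sub, mul_comm s r]
          abel)
    (fun r x => by
      change _ = (r • (1 : Smash k A (Enveloping k A h) R)) * _
      rw [smul_mul_assoc, one_mul]
      exact ((ιLinear k A h).baseChange R).map_smul r x)
    (fun x r => by
      change _ * (r • (1 : Smash k A (Enveloping k A h) R)) -
        (r • (1 : Smash k A (Enveloping k A h) R)) * _ = ⁅x, r⁆ • 1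
      rw [smashL_mul_smul, smul_mul_assoc, one_mul, mul_one, add_sub_cancel_left])

lemma toSmash_ιA (r : R) : toSmash k A h R (ιA k R _ r) = Smash.tmul k r 1 := by
  rw [toSmash, lift_ιA]
  change r • (Smash.tmul k 1 1 : Smash k A (Enveloping k A h) R) = _
  rw [smash_smul_tmul, mul_one]

lemma toSmash_ιL (x : BaseChange A h R) :
    toSmash k A h R (ιL k R _ x) = smashL k A h R x := lift_ιL _ _ _ _ _ x

lemma toSmash_smul (r : R) (v : Enveloping k R (BaseChange A h R)) :
    toSmash k A h R (r • v) = r • toSmash k A h R v := by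
  have h1 : (Smash.tmul k r 1 : Smash k A (Enveloping k A h) R) = r • 1 := by
    change _ = r • Smash.tmul k 1 1
    rw [smash_smul_tmul, mul_one]
  rw [smul_def, map_mul, toSmash_ιA, h1, smul_mul_assoc, one_mul]

variable (k A h R) in
/-- The morphism `U_A(h) → U_R(R ⋊ h)` induced by `a ↦ η a` and `X ↦ 1 ⊗ X`. -/
def toBaseChange : Enveloping k A h →ₐ[k] Enveloping k R (BaseChange A h R) :=
  lift ((ιA k R _).comp (IsScalarTower.toAlgHom k A R))
    { toFun := fun X => ιL k R _ (BaseChange.tmul 1 X)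
      map_add' := fun X Y => by rw [BaseChange.tmul_add, map_add]
      map_smul' := fun c X => by
        rw [← algebraMap_smul A c X, BaseChange.tmul_smul, ← IsScalarTower.algebraMap_apply,
          ← Algebra.smul_def, ← BaseChange.smul_tmul', map_smul, RingHom.id_apply] }
    (fun X Y => by
      simp only [LinearMap.coe_mk, AddHom.coe_mk]
      rw [← ιL_lie, BaseChange.lie_tmul_tmul, lie_base_one (A := A), lie_base_one (A := A), mul_zero, mul_one, BaseChange.zero_tmul,
        BaseChange.zero_tmul, sub_zero, add_zero])
    (fun a X => by
      simp only [LinearMap.coe_mk, AddHom.coe_mk]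
      rw [BaseChange.tmul_smul, ← BaseChange.smul_tmul, ιL_smul]
      rfl)
    (fun X a => by
      simp only [LinearMap.coe_mk, AddHom.coe_mk, AlgHom.comp_apply, IsScalarTower.coe_toAlgHom']
      rw [ιL_mul_ιA, BaseChange.tmul_lie, one_mul, IsDerivationAction.lie_algebraMap])

lemma toBaseChange_ιL (X : h) :
    toBaseChange k A h R (ιL k A h X) = ιL k R _ (BaseChange.tmul 1 X) := lift_ιL _ _ _ _ _ X

lemma toBaseChange_smul (a : A) (u : Enveloping k A h) :
    toBaseChange k A h R (a • u) = algebraMap A R a • toBaseChange k A h R u := by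
  rw [smul_def, map_mul, toBaseChange, lift_ιA]
  rfl

lemma toSmash_toBaseChange (u : Enveloping k A h) :
    toSmash k A h R (toBaseChange k A h R u) = Smash.tmul k 1 u := by
  induction u using induction_left with
  | one => rw [map_one, map_one]; rfl
  | add u v hu hv => rw [map_add, map_add, hu, hv, smash_tmul_add]
  | smul a u hu =>
    rw [toBaseChange_smul, toSmash_smul, hu, smash_smul_tmul, ← Algebra.smul_def]
    exact TensorProduct.smul_tmul a 1 u
  | lie_mul X u hu =>
    rw [map_mul, map_mul, hu, toBaseChange_ιL, toSmash_ιL, smashL_tmul, smash_tmul_ιL_mul,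
      lie_base_one (A := A), mul_zero, one_mul]
    exact add_eq_right.2 (TensorProduct.zero_tmul _ _)

variable (k A h R) in
/-- The inverse `r # u ↦ r • toBaseChange u` of `toSmash`. -/
def ofSmash : Smash k A (Enveloping k A h) R →+ Enveloping k R (BaseChange A h R) :=
  TensorProduct.liftAddHom
    { toFun := fun r =>
        { toFun := fun u => r • toBaseChange k A h R u
          map_zero' := by simp
          map_add' := fun u v => by simp }
      map_zero' := by ext; simp
      map_add' := fun r s => by ext; simp [add_smul] }
    (fun a r u => by
      simp only [AddMonoidHom.coe_mk, ZeroHom.coe_mk]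
      rw [toBaseChange_smul, smul_smul, Algebra.smul_def, mul_comm])

lemma ofSmash_tmul (r : R) (u : Enveloping k A h) :
    ofSmash k A h R (Smash.tmul k r u) = r • toBaseChange k A h R u := rfl

lemma ofSmash_smul (r : R) (y : Smash k A (Enveloping k A h) R) :
    ofSmash k A h R (r • y) = r • ofSmash k A h R y := by
  induction y using Smash.induction with
  | zero => simp only [smul_zero, map_zero]
  | add x y hx hy => simp only [smul_add, map_add, hx, hy]
  | tmul s u => rw [smash_smul_tmul, ofSmash_tmul, ofSmash_tmul, mul_smul]

lemma ofSmash_smashL_mul (x : BaseChange A h R) (y : Smash k A (Enveloping k A h) R) :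
    ofSmash k A h R (smashL k A h R x * y) = ιL k R _ x * ofSmash k A h R y := by
  induction x using BaseChange.induction with
  | zero => simp only [map_zero, zero_mul]
  | add x x' hx hx' => simp only [map_add, add_mul, hx, hx']
  | tmul r X =>
    induction y using Smash.induction with
    | zero => simp only [mul_zero, map_zero]
    | add y y' hy hy' => simp only [mul_add, map_add, hy, hy']
    | tmul s u =>
      have hX : ιL k R _ (BaseChange.tmul r X) =
          r • ιL k R (BaseChange A h R) (BaseChange.tmul 1 X) := by
        rw [smul_def, ← ιL_smul, BaseChange.smul_tmul, mul_one]
      rw [smashL_tmul, smash_tmul_ιL_mul, map_add, ofSmash_tmul, ofSmash_tmul, ofSmash_tmul,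
        ιL_mul_smul, BaseChange.tmul_lie, hX, map_mul, toBaseChange_ιL, smul_mul_assoc, smul_smul,
        mul_comm s r, add_comm]

lemma ofSmash_toSmash (v : Enveloping k R (BaseChange A h R)) :
    ofSmash k A h R (toSmash k A h R v) = v := by
  induction v using induction_left with
  | one =>
    rw [map_one]
    change ofSmash k A h R (Smash.tmul k 1 1) = 1
    rw [ofSmash_tmul, map_one, one_smul]
  | add u v hu hv => rw [map_add, map_add, hu, hv]
  | smul r u hu => rw [toSmash_smul, ofSmash_smul, hu]
  | lie_mul x u hu => rw [map_mul, toSmash_ιL, ofSmash_smashL_mul, hu]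

lemma toSmash_ofSmash (y : Smash k A (Enveloping k A h) R) :
    toSmash k A h R (ofSmash k A h R y) = y := by
  induction y using Smash.induction with
  | zero => simp only [map_zero]
  | add x y hx hy => rw [map_add, map_add, hx, hy]
  | tmul r u => rw [ofSmash_tmul, toSmash_smul, toSmash_toBaseChange, smash_smul_tmul, mul_one]

variable (k A h R) in
/-- The `R`-linear isomorphism `U_R(R ⋊ h) ≃ R # U_A(h)`. -/
def smashEquiv : Enveloping k R (BaseChange A h R) ≃ₗ[R] Smash k A (Enveloping k A h) R where
  toFun := toSmash k A h R
  map_add' := map_add _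
  map_smul' := toSmash_smul
  invFun := ofSmash k A h R
  left_inv := ofSmash_toSmash
  right_inv := toSmash_ofSmash

lemma smashEquiv_apply (v : Enveloping k R (BaseChange A h R)) :
    smashEquiv k A h R v = toSmash k A h R v := rfl

lemma smashEquiv_mul (u v : Enveloping k R (BaseChange A h R)) :
    smashEquiv k A h R (u * v) = smashEquiv k A h R u * smashEquiv k A h R v :=
  map_mul (toSmash k A h R) u v

/-! ### Compatibility of the isomorphism with the coalgebra structures -/

lemma smash_counit_tmul (r : R) (u : Enveloping k A h) :
    counit (R := R) (Smash.tmul k r u : Smash k A (Enveloping k A h) R) =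
      r * algebraMap A R (counit (R := A) u) := by
  rw [mul_comm, ← Algebra.smul_def]
  rfl

lemma smash_counit_smashL_mul (x : BaseChange A h R) (y : Smash k A (Enveloping k A h) R) :
    counit (R := R) (smashL k A h R x * y) = ⁅x, counit (R := R) y⁆ := by
  induction x using BaseChange.induction with
  | zero => simp only [map_zero, zero_mul, zero_lie]
  | add x x' hx hx' => simp only [map_add, add_mul, hx, hx', add_lie]
  | tmul r X =>
    induction y using Smash.induction with
    | zero => simp only [mul_zero, map_zero, lie_zero]
    | add y y' hy hy' => simp only [mul_add, map_add, hy, hy', lie_add]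
    | tmul s u =>
      rw [smashL_tmul, smash_tmul_ιL_mul, map_add, smash_counit_tmul, smash_counit_tmul,
        smash_counit_tmul, counit_ιL_mul, BaseChange.tmul_lie,
        IsDerivationAction.lie_mul (A := A), IsDerivationAction.lie_algebraMap]
      ring

lemma counit_smashEquiv (v : Enveloping k R (BaseChange A h R)) :
    counit (R := R) (smashEquiv k A h R v) = counit (R := R) v := by
  induction v using induction_left with
  | one =>
    rw [smashEquiv_apply, map_one, counit_apply, one_smul]
    change counit (R := R) (Smash.tmul k 1 1) = 1
    rw [smash_counit_tmul, counit_apply, one_smul, map_one, mul_one]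
  | add u v hu hv => rw [map_add, map_add, map_add, hu, hv]
  | smul r u hu => rw [map_smul, map_smul, map_smul, hu]
  | lie_mul x u hu =>
    rw [smashEquiv_mul, smashEquiv_apply (ιL _ _ _ x), toSmash_ιL, smash_counit_smashL_mul, hu,
      counit_ιL_mul]

variable (k A h R) in
/-- The map `u ⊗ v ↦ (1 # u) ⊗ (1 # v)`, through which the coproduct of the smash product is
defined. -/
def smashTensor : Enveloping k A h ⊗[A] Enveloping k A h →+
    Smash k A (Enveloping k A h) R ⊗[R] Smash k A (Enveloping k A h) R :=
  (TensorProduct.AlgebraTensorModule.distribBaseChange A R _ _).toAddMonoidHom.comp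
    (TensorProduct.mk A R _ 1).toAddMonoidHom

lemma smashTensor_tmul (u v : Enveloping k A h) :
    smashTensor k A h R (u ⊗ₜ v) = Smash.tmul k 1 u ⊗ₜ Smash.tmul k 1 v := rfl

lemma smash_comul_tmul (r : R) (u : Enveloping k A h) :
    comul (R := R) (Smash.tmul k r u : Smash k A (Enveloping k A h) R) =
      r • smashTensor k A h R (comul (R := A) u) := by
  have h1 : r ⊗ₜ[A] comul (R := A) u = r • ((1 : R) ⊗ₜ[A] comul (R := A) u) := by
    rw [TensorProduct.smul_tmul', smul_eq_mul, mul_one]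
  change TensorProduct.AlgebraTensorModule.distribBaseChange A R _ _
    (r ⊗ₜ[A] comul (R := A) u) = _
  rw [h1, map_smul]
  rfl

/-- The diagonal operator `smashL x ⊗ 1 + 1 ⊗ smashL x` on the tensor square of the smash product. -/
def smashDiag (x : BaseChange A h R) :
    Smash k A (Enveloping k A h) R ⊗[R] Smash k A (Enveloping k A h) R →+
      Smash k A (Enveloping k A h) R ⊗[R] Smash k A (Enveloping k A h) R :=
  tensorDerivation (fun r : R => ⁅x, r⁆) (AddMonoidHom.mulLeft (smashL k A h R x))
    (AddMonoidHom.mulLeft (smashL k A h R x)) (smashL_mul_smul x) (smashL_mul_smul x)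

lemma smashDiag_tmul (x : BaseChange A h R) (y z : Smash k A (Enveloping k A h) R) :
    smashDiag x (y ⊗ₜ[R] z) =
      (smashL k A h R x * y) ⊗ₜ[R] z + y ⊗ₜ[R] (smashL k A h R x * z) := rfl

lemma smashDiag_add (x x' : BaseChange A h R)
    (t : Smash k A (Enveloping k A h) R ⊗[R] Smash k A (Enveloping k A h) R) :
    smashDiag (x + x') t = smashDiag x t + smashDiag x' t := by
  induction t with
  | zero => simp
  | add y z hy hz => simp only [map_add, hy, hz]; abel
  | tmul y z =>
    simp only [smashDiag_tmul, map_add, add_mul, TensorProduct.add_tmul, TensorProduct.tmul_add]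
    abel

lemma smashDiag_zero (t : Smash k A (Enveloping k A h) R ⊗[R] Smash k A (Enveloping k A h) R) :
    smashDiag (0 : BaseChange A h R) t = 0 := by
  have := smashDiag_add (0 : BaseChange A h R) 0 t
  rwa [add_zero, left_eq_add] at this

lemma smashDiag_smul (x : BaseChange A h R) (r : R)
    (t : Smash k A (Enveloping k A h) R ⊗[R] Smash k A (Enveloping k A h) R) :
    smashDiag x (r • t) = r • smashDiag x t + ⁅x, r⁆ • t := by
  induction t with
  | zero => simp
  | add y z hy hz => simp only [smul_add, map_add, hy, hz]; abel
  | tmul y z =>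
    simp only [TensorProduct.smul_tmul', smashDiag_tmul, smashL_mul_smul, TensorProduct.add_tmul,
      smul_add]
    abel

lemma smashDiag_smashTensor (r : R) (X : h) (t : Enveloping k A h ⊗[A] Enveloping k A h) :
    smashDiag (BaseChange.tmul r X) (smashTensor k A h R t) =
      r • smashTensor k A h R (diagLie k A h X t) := by
  induction t with
  | zero => simp
  | add y z hy hz => simp only [map_add, smul_add, hy, hz]
  | tmul u v =>
    have h2 (w : Enveloping k A h) : (Smash.tmul k r (ιL k A h X) * Smash.tmul k 1 w :
        Smash k A (Enveloping k A h) R) = r • Smash.tmul k 1 (ιL k A h X * w) := by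
      rw [smash_tmul_ιL_mul, lie_base_one (A := A), mul_zero, smash_smul_tmul]
      exact add_eq_right.2 (TensorProduct.zero_tmul _ _)
    rw [diagLie_tmul, map_add, smashTensor_tmul, smashTensor_tmul, smashTensor_tmul,
      smashDiag_tmul, smashL_tmul, h2, h2, smul_add, TensorProduct.smul_tmul',
      TensorProduct.tmul_smul]

lemma smash_comul_smashL_mul (x : BaseChange A h R) (y : Smash k A (Enveloping k A h) R) :
    comul (R := R) (smashL k A h R x * y) = smashDiag x (comul (R := R) y) := by
  induction x using BaseChange.induction with
  | zero => simp only [map_zero, zero_mul, smashDiag_zero]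
  | add x x' hx hx' => simp only [map_add, add_mul, hx, hx', smashDiag_add]
  | tmul r X =>
    induction y using Smash.induction with
    | zero => simp only [mul_zero, map_zero]
    | add y y' hy hy' => simp only [mul_add, map_add, hy, hy']
    | tmul s u =>
      rw [smashL_tmul, smash_tmul_ιL_mul, map_add, smash_comul_tmul, smash_comul_tmul,
        smash_comul_tmul, comul_ιL_mul, smashDiag_smul, smashDiag_smashTensor,
        BaseChange.tmul_lie, smul_smul, mul_comm s r, add_comm]

lemma comul_smashEquiv (v : Enveloping k R (BaseChange A h R)) :
    comul (R := R) (smashEquiv k A h R v) =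
      TensorProduct.congr (smashEquiv k A h R) (smashEquiv k A h R) (comul (R := R) v) := by
  induction v using induction_left with
  | one =>
    rw [comul_one, TensorProduct.congr_tmul, smashEquiv_apply, map_one]
    change comul (R := R) (Smash.tmul k 1 1) = _
    rw [smash_comul_tmul, comul_one, one_smul]
    rfl
  | add u v hu hv => simp only [map_add, hu, hv]
  | smul r u hu => simp only [map_smul, hu]
  | lie_mul x u hu =>
    rw [smashEquiv_mul, smashEquiv_apply (ιL _ _ _ x), toSmash_ιL, smash_comul_smashL_mul, hu,
      comul_ιL_mul]
    generalize comul (R := R) u = t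
    induction t with
    | zero => simp
    | add y z hy hz => simp only [map_add, hy, hz]
    | tmul y z =>
      rw [TensorProduct.congr_tmul, smashDiag_tmul, diagLie_tmul, map_add,
        TensorProduct.congr_tmul, TensorProduct.congr_tmul, smashEquiv_mul, smashEquiv_mul,
        smashEquiv_apply (ιL _ _ _ x), toSmash_ιL]

end Enveloping

end

end LieRinehartAlgebra

end

theorem proposition1p14
    {k A h R : Type*} [Field k] [CharZero k]
    -- a Lie-Rinehart algebra `(A, h)` over `k`, with anchor `X ↦ (a ↦ ⁅X, a⁆)`
    [CommRing A] [Algebra k A] [LieRing h] [LieAlgebra k h] [Module A h] [LieRingModule h A]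
    [LieRinehartRing A h] [LieRinehartAlgebra k A h] [Module.Projective A h]
    -- a commutative algebra `R` with `η = algebraMap A R` and `ρ X r = ⁅X, r⁆`
    [CommRing R] [Algebra k R] [Algebra A R] [IsScalarTower k A R]
    [LieRingModule h R] [LieModule k h R] [IsDerivationAction A h R] :
    -- the module algebra structure and the smash product
    ∃ (_ : IsCocommLeftHopfAlgebroid k A (Enveloping k A h))
      (_ : IsModuleAlgebra k A (Enveloping k A h) R)
      (_ : IsCocommLeftHopfAlgebroid k R (Smash k A (Enveloping k A h) R)),
      (∀ (a : A) (r : R), Enveloping.ιA k A h a • r = algebraMap A R a * r) ∧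
      (∀ (X : h) (r : R), Enveloping.ιL k A h X • r = ⁅X, r⁆) ∧
      -- the Lie-Rinehart algebra `R ⋊ h`
      ∃ (_ : LieRinehartRing R (BaseChange A h R)) (_ : LieRinehartAlgebra k R (BaseChange A h R)),
        (∀ (r r' : R) (X Y : h),
          ⁅(BaseChange.tmul r X : BaseChange A h R), (BaseChange.tmul r' Y : BaseChange A h R)⁆ =
            BaseChange.tmul (r * r') ⁅X, Y⁆ - BaseChange.tmul (r' * ⁅Y, r⁆) X +
              BaseChange.tmul (r * ⁅X, r'⁆) Y) ∧
        (∀ (r s : R) (X : h),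
          LieRinehartAlgebra.anchor k R (BaseChange A h R) (BaseChange.tmul r X) s = r * ⁅X, s⁆) ∧
        -- the isomorphism
        ∃ (_ : IsCocommLeftHopfAlgebroid k R (Enveloping k R (BaseChange A h R)))
          (e : HopfAlgebroidEquiv k R (Enveloping k R (BaseChange A h R))
            (Smash k A (Enveloping k A h) R)),
          (∀ r : R, e (Enveloping.ιA k R (BaseChange A h R) r) = Smash.tmul k r 1) ∧
          (∀ (r : R) (X : h), e (Enveloping.ιL k R (BaseChange A h R) (BaseChange.tmul r X)) =
            Smash.tmul k r (Enveloping.ιL k A h X)) ∧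
          ∀ f : Enveloping k R (BaseChange A h R) →ₐ[k] Smash k A (Enveloping k A h) R,
            (∀ r : R, f (Enveloping.ιA k R (BaseChange A h R) r) = Smash.tmul k r 1) →
            (∀ (r : R) (X : h), f (Enveloping.ιL k R (BaseChange A h R) (BaseChange.tmul r X)) =
              Smash.tmul k r (Enveloping.ιL k A h X)) →
            ∀ u, f u = e u := by
  have hU := Enveloping.isCocommLeftHopfAlgebroid k A h
  have hR := Enveloping.isModuleAlgebra k A h R
  have hL := BaseChange.lieRinehartRing A h R
  have hLk := BaseChange.lieRinehartAlgebra k A h R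
  have hV := Enveloping.isCocommLeftHopfAlgebroid k R (BaseChange A h R)
  have hS : IsCocommLeftHopfAlgebroid k R (Smash k A (Enveloping k A h) R) :=
    .of_equiv (Enveloping.smashEquiv k A h R) Enveloping.smashEquiv_mul
      Enveloping.comul_smashEquiv Enveloping.counit_smashEquiv
  refine ⟨hU, hR, hS, fun a r => ?_, Enveloping.ιL_smul_eq, hL, hLk,
    BaseChange.lie_tmul_tmul, fun _ _ _ => rfl, hV,
    HopfAlgebroidEquiv.ofLinearEquiv k (Enveloping.smashEquiv k A h R) Enveloping.smashEquiv_mul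
      Enveloping.comul_smashEquiv Enveloping.counit_smashEquiv,
    Enveloping.toSmash_ιA, fun r X => Enveloping.toSmash_ιL (BaseChange.tmul r X),
    fun f hfA hfL => DFunLike.congr_fun (F := _ →ₐ[k] _) (g := Enveloping.toSmash k A h R) ?_⟩
  · rw [Enveloping.ιA_smul, Algebra.smul_def]
  · refine Enveloping.hom_ext (fun r => by rw [hfA, Enveloping.toSmash_ιA]) fun x => ?_
    induction x using BaseChange.induction with
    | zero => rw [map_zero, map_zero, map_zero]
    | add x y hx hy => rw [map_add, map_add, map_add, hx, hy]
    | tmul r X => rw [hfL, Enveloping.toSmash_ιL, Enveloping.smashL_tmul]
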